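/- All Hilbert spaces are finite-dimensional complex; $d_A=\dim A$, $\log$ is the logarithm to base 2, real and complex powers of a positive semidefinite operator are taken on its support (and are zero on its kernel), and identity maps on additional tensor factors are omitted. A channel is a completely positive trace-preserving linear map. Let $\rho_A$ be a quantum state on $A$ and let $\mathcal N_{A\to B}$ be a channel from operators on $A$ to operators on $B$. Let $|\rho\rangle_{RA}$ be a purification of $\rho_A$, i.e. $\operatorname{tr}_R|\rho\rangle\langle\rho|_{RA}=\rho_A$, and let $\sigma_{RB}:=\mathcal N_{A\to B}(|\rho\rangle\langle\rho|_{RA})$. Entanglement fidelity: $F_e(\rho_A,\mathcal M):=F^2(|\rho\rangle\langle\rho|_{RA},\mathcal M(|\rho\rangle\langle\rho|_{RA}))$, where $F(\rho,\tau)=\|\rho^{1/2}\tau^{1/2}\|_1$; this does not depend on the purification. Entropies: $H(A)_\rho=-\operatorname{tr}[\rho\log\rho]$ and $H(A|B)_\rho=H(AB)_\rho-H(B)_\rho$. Petz decoder: $\mathcal D^{\mathrm P}(X)=\rho_A^{1/2}\,\mathcal N^\dagger\big(\mathcal N(\rho_A)^{-1/2}X\,\mathcal N(\rho_A)^{-1/2}\big)\rho_A^{1/2}$.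 Twirled Petz decoder: $\mathcal D^{\mathrm{P,twirled}}(X)=\int_{-\infty}^\infty \beta_0(t)\,\mathcal R^{t/2}(X)\,dt$ with $\beta_0(t)=\frac{\pi}{2}(\cosh(\pi t)+1)^{-1}$ and $\mathcal R^{t}(X)=\rho_A^{\frac12-it}\,\mathcal N^\dagger\big(\mathcal N(\rho_A)^{-\frac12+it}X\,\mathcal N(\rho_A)^{-\frac12-it}\big)\rho_A^{\frac12+it}$. Schumacher–Westmoreland (SW) decoder: let $d=\operatorname{rank}\rho_A$, let $\tilde R$ be a $d$-dimensional space, and choose a purification of $\rho_A$ on $\tilde R\otimes A$ with Schmidt form $\sum_{k}\sqrt{\lambda_k}\,|r_k\rangle|a_k\rangle$ ($(r_k)_{k<d}$ an orthonormal basis of $\tilde R$, $(a_k)_{k<d}$ orthonormal in $A$, $\lambda$ a probability distribution). Let $E=A\otimes B'$ with $B'\cong B$, and choose an isometry $V:A\to B\otimes E$ with $\mathcal N(X)=\operatorname{tr}_E[VXV^\dagger]$ for all $X$. Let $|\tilde\sigma\rangle_{\tilde RBE}=V\sum_k\sqrt{\lambda_k}|r_k\rangle|a_k\rangle$, and denote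 the reduced states of $|\tilde\sigma\rangle\langle\tilde\sigma|$ by $\tilde\sigma_{\tilde RE}$, etc. Choose a spectral decomposition $\tilde\sigma_E=\sum_l\mu_l|e_l\rangle\langle e_l|$ with $(e_l)$ an orthonormal basis of $E$. Let $R'\cong\tilde R$, let $A'\cong A$, let $E'=A'\otimes B\cong E$, and let $|\phi_{k,l}\rangle=|r_k\rangle|e_l\rangle\in R'\otimes E'$. Let $|\Psi\rangle=\sum_{k,l}\big(\tilde\sigma_{\tilde RE}^{1/2}|r_k\rangle|e_l\rangle\big)\otimes|\phi_{k,l}\rangle$, and let $M$ be the operator on $R'\otimes E'$ that is the transpose, in the basis $(r_k\otimes e_l)$, of $(\tilde\sigma_{\tilde R}\otimes\tilde\sigma_E)^{1/2}\tilde\sigma_{\tilde RE}^{1/2}$. Choose a singular value decomposition $M=\hat U\Sigma\tilde U$ with $\hat U,\tilde U$ unitary and $\Sigma\ge 0$ diagonal in the basis $(\phi_{k,l})$, and let $U=\tilde U^\dagger\hat U^\dagger$. Choose a unit vector $|0\rangle\in R'\otimes A'$ and a unitary $W$ on $R'\otimes E'$ with $|\Psi\rangle=W(|\tilde\sigma\rangle\otimes|0\rangle)$.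 With $K_l=\sum_k|a_k\rangle\langle\phi_{k,l}|UW$, the SW decoder is $\mathcal D^{\mathrm{SW}}(X)=\sum_l K_l\,(X\otimes|0\rangle\langle 0|)\,K_l^\dagger$. Then the following assertions are equivalent. (a) There is a channel $\mathcal D_{B\to A}$ with $F_e(\rho_A,\mathcal D\circ\mathcal N)=1$. (b) The SW decoder satisfies $F_e(\rho_A,\mathcal D^{\mathrm{SW}}\circ\mathcal N)=1$ (for every way of making the choices in its construction; equivalently, for some way of making them). (c) The Petz decoder satisfies $F_e(\rho_A,\mathcal D^{\mathrm P}\circ\mathcal N)=1$. (d) The twirled Petz decoder satisfies $F_e(\rho_A,\mathcal D^{\mathrm{P,twirled}}\circ\mathcal N)=1$. (e) $H(R|B)_\sigma=H(R|A)_\rho$, where the right-hand side refers to $|\rho\rangle\langle\rho|_{RA}$. (f) If a vector $|\sigma\rangle_{RBE}$, for any finite-dimensional $E$, satisfies $\operatorname{tr}_E|\sigma\rangle\langle\sigma|_{RBE}=\sigma_{RB}$, then $\sigma_{RE}=\sigma_R\otimes\sigma_E$ (for every such vector; equivalently, for some such vector). -/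

import Mathlib

open Matrix MeasureTheory
open scoped Kronecker ComplexOrder

/-!
Finite-dimensional Hilbert spaces are the spaces `A → ℂ` over finite index types `A`; operators are
square complex matrices, and `A ⊗ B` is indexed by `A × B`.
-/

namespace QRecovery

noncomputable section

/-! ### Vectors, states, partial traces -/

/-- The rank-one operator `|v⟩⟨w|`. -/
def ketbra {A B : Type*} (v : A → ℂ) (w : B → ℂ) : Matrix A B ℂ := vecMulVec v (star w)

/-- Quantum states (density operators). -/
def IsState {A : Type*} [Fintype A] (ρ : Matrix A A ℂ) : Prop := ρ.PosSemidef ∧ ρ.trace = 1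

/-- The partial trace over the first tensor factor. -/
def trFst {A B : Type*} [Fintype A] (X : Matrix (A × B) (A × B) ℂ) : Matrix B B ℂ :=
  Matrix.of fun b b' => ∑ a, X (a, b) (a, b')

/-- The partial trace over the second tensor factor. -/
def trSnd {A B : Type*} [Fintype B] (X : Matrix (A × B) (A × B) ℂ) : Matrix A A ℂ :=
  Matrix.of fun a a' => ∑ b, X (a, b) (a', b)

/-- The partial trace over the middle factor `B` of a tripartite system `(R ⊗ B) ⊗ E`. -/
def trMid {R B E : Type*} [Fintype B] (X : Matrix ((R × B) × E) ((R × B) × E) ℂ) :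
    Matrix (R × E) (R × E) ℂ :=
  Matrix.of fun i j => ∑ b, X ((i.1, b), i.2) ((j.1, b), j.2)

/-! ### Channels -/

/-- The map `id_R ⊗ Φ`, acting blockwise. -/
def ampliation {R A B : Type*} (Φ : Matrix A A ℂ → Matrix B B ℂ)
    (X : Matrix (R × A) (R × A) ℂ) : Matrix (R × B) (R × B) ℂ :=
  Matrix.of fun i j => Φ (Matrix.of fun a a' => X (i.1, a) (j.1, a')) i.2 j.2

/-- Complete positivity. -/
def IsCompletelyPositive {A B : Type*} (Φ : Matrix A A ℂ → Matrix B B ℂ) : Prop :=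
  ∀ (n : ℕ) (X : Matrix (Fin n × A) (Fin n × A) ℂ), X.PosSemidef → (ampliation Φ X).PosSemidef

/-- Quantum channels: completely positive, trace-preserving linear maps. -/
structure IsChannel {A B : Type*} [Fintype A] [Fintype B]
    (Φ : Matrix A A ℂ → Matrix B B ℂ) : Prop where
  isLinearMap : IsLinearMap ℂ Φ
  completelyPositive : IsCompletelyPositive Φ
  trace_preserving : ∀ X, (Φ X).trace = X.trace

/-- The adjoint of a map of operators with respect to the inner product `⟨X, Y⟩ = tr (Xᴴ Y)`
(see `trace_adjointMap`). -/
def adjointMap {A B : Type*} [DecidableEq A] [Fintype B] (Φ : Matrix A A ℂ → Matrix B B ℂ)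
    (Y : Matrix B B ℂ) : Matrix A A ℂ :=
  Matrix.of fun i j => ((Φ (Matrix.single i j 1))ᴴ * Y).trace

theorem trace_adjointMap {A B : Type*} [Fintype A] [DecidableEq A] [Fintype B]
    {Φ : Matrix A A ℂ → Matrix B B ℂ} (hΦ : IsLinearMap ℂ Φ) (X : Matrix A A ℂ)
    (Y : Matrix B B ℂ) : (Xᴴ * adjointMap Φ Y).trace = ((Φ X)ᴴ * Y).trace := by
  have h : Φ X = ∑ i, ∑ j, X i j • Φ (Matrix.single i j 1) := by
    conv_lhs => rw [Matrix.matrix_eq_sum_single X]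
    rw [← IsLinearMap.mk'_apply (lin := hΦ)]
    simp only [map_sum]
    refine Finset.sum_congr rfl fun i _ => Finset.sum_congr rfl fun j _ => ?_
    have : Matrix.single i j (X i j) = X i j • Matrix.single i j (1 : ℂ) := by
      simp [Matrix.smul_single]
    rw [this, map_smul]
    simp
  rw [h]
  simp only [conjTranspose_sum, conjTranspose_smul, Finset.sum_mul, trace_sum, smul_mul_assoc,
    trace_smul]
  rw [Finset.sum_comm]
  simp [Matrix.trace, Matrix.mul_apply, adjointMap]

/-! ### Powers, entropy, fidelity -/

/-- The real power `X ^ p` of a positive semidefinite `X`, taken on the support of `X`. -/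
def rpow {A : Type*} [Fintype A] [DecidableEq A] (X : Matrix A A ℂ) (p : ℝ) : Matrix A A ℂ :=
  cfc (fun x : ℝ => if x = 0 then 0 else x ^ p) X

/-- The complex power `X ^ z` of a positive semidefinite `X`, taken on the support of `X`. -/
def cpow {A : Type*} [Fintype A] [DecidableEq A] (X : Matrix A A ℂ) (z : ℂ) : Matrix A A ℂ :=
  cfc (fun x : ℝ => if x = 0 then 0 else ((x : ℂ) ^ z).re) X +
    Complex.I • cfc (fun x : ℝ => if x = 0 then 0 else ((x : ℂ) ^ z).im) X

/-- The von Neumann entropy `-tr (ρ log₂ ρ)`. -/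
def entropy {A : Type*} [Fintype A] [DecidableEq A] (ρ : Matrix A A ℂ) : ℝ :=
  -(ρ * cfc (Real.logb 2) ρ).trace.re

/-- The conditional entropy `H(A|B) = H(AB) - H(B)` of a state on `A ⊗ B`. -/
def condEntropy {A B : Type*} [Fintype A] [DecidableEq A] [Fintype B] [DecidableEq B]
    (ρ : Matrix (A × B) (A × B) ℂ) : ℝ :=
  entropy ρ - entropy (trFst ρ)

/-- The trace norm `tr |X|`, where `|X| = (Xᴴ X) ^ (1/2)`. -/
def traceNorm {A : Type*} [Fintype A] [DecidableEq A] (X : Matrix A A ℂ) : ℝ :=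
  (rpow (Xᴴ * X) (1 / 2)).trace.re

/-- The fidelity `F(ρ, τ) = ‖ρ ^ (1/2) τ ^ (1/2)‖₁`. -/
def fidelity {A : Type*} [Fintype A] [DecidableEq A] (ρ τ : Matrix A A ℂ) : ℝ :=
  traceNorm (rpow ρ (1 / 2) * rpow τ (1 / 2))

/-- The purification `∑ r, |r⟩ ⊗ ρ ^ (1/2) |r⟩` of `ρ`. -/
def canonicalPurification {A : Type*} [Fintype A] [DecidableEq A] (ρ : Matrix A A ℂ) :
    A × A → ℂ :=
  fun i => rpow ρ (1 / 2) i.2 i.1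

/-- The entanglement fidelity `F_e(ρ, M) = F²(|ρ⟩⟨ρ|, (id ⊗ M)(|ρ⟩⟨ρ|))`, computed with the
canonical purification of `ρ`. By `entanglementFidelity_eq`, any other purification gives the
same value. -/
def entanglementFidelity {A : Type*} [Fintype A] [DecidableEq A] (ρ : Matrix A A ℂ)
    (M : Matrix A A ℂ → Matrix A A ℂ) : ℝ :=
  fidelity (ketbra (canonicalPurification ρ) (canonicalPurification ρ))
    (ampliation M (ketbra (canonicalPurification ρ) (canonicalPurification ρ))) ^ 2

theorem rpow_half_mul_self {A : Type*} [Fintype A] [DecidableEq A] {X : Matrix A A ℂ}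
    (hX : X.PosSemidef) : rpow X (1 / 2) * rpow X (1 / 2) = X := by
  have hsa : IsSelfAdjoint X := hX.1
  have hs := (Matrix.posSemidef_iff_isHermitian_and_spectrum_nonneg.1 hX).2
  unfold rpow
  rw [← cfc_mul _ _ X (by exact (Matrix.finite_real_spectrum (A := X)).continuousOn _)
    (by exact (Matrix.finite_real_spectrum (A := X)).continuousOn _)]
  conv_rhs => rw [← cfc_id' ℝ X]
  refine cfc_congr fun x hx => ?_
  have hx0 : 0 ≤ x := by
    have := hs ((spectrum.algebraMap_mem_iff ℂ).2 hx)
    simpa using this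
  by_cases h0 : x = 0
  · simp [h0]
  · simp only [h0, if_false]
    rw [← Real.sqrt_eq_rpow, Real.mul_self_sqrt hx0]

theorem rpow_half_isHermitian {A : Type*} [Fintype A] [DecidableEq A] (X : Matrix A A ℂ) :
    (rpow X (1 / 2)).IsHermitian := by
  exact cfc_predicate (p := IsSelfAdjoint) _ X

theorem rpow_half_of_mul_self {A : Type*} [Fintype A] [DecidableEq A] {Y : Matrix A A ℂ}
    (hY : Y.PosSemidef) : rpow (Y * Y) (1 / 2) = Y := by
  have hsa : IsSelfAdjoint Y := hY.1
  have hs := (Matrix.posSemidef_iff_isHermitian_and_spectrum_nonneg.1 hY).2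
  unfold rpow
  rw [← pow_two, ← cfc_comp_pow (R := ℝ) _ 2 Y
    (by exact ((Matrix.finite_real_spectrum (A := Y)).image _).continuousOn _)]
  conv_rhs => rw [← cfc_id' ℝ Y]
  refine cfc_congr fun x hx => ?_
  have hx0 : 0 ≤ x := by
    have := hs ((spectrum.algebraMap_mem_iff ℂ).2 hx)
    simpa using this
  by_cases h0 : x = 0
  · simp [h0]
  · simp only [pow_eq_zero_iff, ne_eq, OfNat.ofNat_ne_zero, not_false_eq_true, h0, if_false]
    rw [← Real.sqrt_eq_rpow, Real.sqrt_sq hx0]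

theorem ketbra_posSemidef {A : Type*} [Fintype A] (v : A → ℂ) : (ketbra v v).PosSemidef :=
  Matrix.posSemidef_vecMulVec_self_star v

theorem ketbra_mul_self {A : Type*} [Fintype A] (v : A → ℂ) :
    ketbra v v * ketbra v v = (star v ⬝ᵥ v) • ketbra v v := by
  simp [ketbra, Matrix.vecMulVec_mul_vecMulVec]

theorem fidelity_ketbra_sq {A : Type*} [Fintype A] [DecidableEq A] {v : A → ℂ}
    (hv : star v ⬝ᵥ v = 1) {τ : Matrix A A ℂ} (hτ : τ.PosSemidef) :
    fidelity (ketbra v v) τ ^ 2 = (star v ⬝ᵥ (τ *ᵥ v)).re := by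
  have h1 : rpow (ketbra v v) (1 / 2) = ketbra v v := by
    have := rpow_half_of_mul_self (ketbra_posSemidef v)
    rwa [ketbra_mul_self, hv, one_smul] at this
  set S := rpow τ (1 / 2) with hS
  have hSS : S * S = τ := rpow_half_mul_self hτ
  have hSH : Sᴴ = S := rpow_half_isHermitian τ
  set w := S *ᵥ v with hw
  have hww : star w ⬝ᵥ w = star v ⬝ᵥ (τ *ᵥ v) := by
    rw [hw, star_mulVec, ← dotProduct_mulVec, hSH, mulVec_mulVec, hSS]
  have h2 : (ketbra v v * S)ᴴ * (ketbra v v * S) = ketbra w w := by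
    rw [conjTranspose_mul, hSH, (ketbra_posSemidef v).1.eq, Matrix.mul_assoc,
      ← Matrix.mul_assoc (ketbra v v), ketbra_mul_self, hv, one_smul]
    simp only [ketbra, hw, star_mulVec, hSH]
    rw [Matrix.vecMulVec_mul, Matrix.mul_vecMulVec]
  have hn : 0 ≤ star w ⬝ᵥ w := dotProduct_star_self_nonneg w
  obtain ⟨c, hc0, hc⟩ : ∃ c : ℝ, 0 ≤ c ∧ star w ⬝ᵥ w = (c : ℂ) :=
    ⟨(star w ⬝ᵥ w).re, (Complex.nonneg_iff.1 hn).1,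
      Complex.ext rfl (by simpa using (Complex.nonneg_iff.1 hn).2.symm)⟩
  have h3 : ((√c)⁻¹ • ketbra w w) * ((√c)⁻¹ • ketbra w w) = ketbra w w := by
    rw [smul_mul_smul_comm, ketbra_mul_self, hc]
    rcases hc0.eq_or_lt with h | h
    · have : w = 0 := by
        rw [← h] at hc
        exact dotProduct_star_self_eq_zero.1 (by simpa using hc)
      simp [this, ketbra]
    · rw [← mul_inv, Real.mul_self_sqrt hc0]
      ext i j
      have : (c : ℂ) ≠ 0 := by exact_mod_cast h.ne'
      simp [this]
  have h4 : rpow (ketbra w w) (1 / 2) = (√c)⁻¹ • ketbra w w := by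
    have := rpow_half_of_mul_self (Y := (√c)⁻¹ • ketbra w w)
      ((ketbra_posSemidef w).smul (by positivity))
    rwa [h3] at this
  have h5 : (ketbra w w).trace = (c : ℂ) := by
    rw [← hc, ketbra, Matrix.trace_vecMulVec, dotProduct_comm]
  unfold fidelity traceNorm
  rw [h1, h2, h4, trace_smul, h5, ← hww, hc]
  simp only [Complex.real_smul, ← Complex.ofReal_mul, Complex.ofReal_re]
  rw [mul_pow, inv_pow, Real.sq_sqrt hc0]
  rcases hc0.eq_or_lt with h | h
  · simp [← h]
  · field_simp

theorem ampliation_posSemidef {R A B : Type*} [Fintype R] {Φ : Matrix A A ℂ → Matrix B B ℂ}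
    (hΦ : IsCompletelyPositive Φ) {X : Matrix (R × A) (R × A) ℂ} (hX : X.PosSemidef) :
    (ampliation Φ X).PosSemidef := by
  have f := Fintype.equivFin R
  have := hΦ _ _ (hX.submatrix (Prod.map f.symm id))
  have h := this.submatrix (Prod.map f id)
  convert h using 1
  ext i j
  simp [ampliation]

theorem inner_ampliation {R A : Type*} [Fintype R] [Fintype A] [DecidableEq A]
    {ρ : Matrix A A ℂ} {M : Matrix A A ℂ → Matrix A A ℂ} (hM : IsLinearMap ℂ M) (ψ : R × A → ℂ)
    (hψ : trFst (ketbra ψ ψ) = ρ) :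
    star ψ ⬝ᵥ (ampliation M (ketbra ψ ψ) *ᵥ ψ) =
      ∑ a, ∑ a', ∑ b, ∑ b', ρ b a * ρ a' b' * M (Matrix.single b b' 1) a a' := by
  have h (X : Matrix A A ℂ) (a a' : A) :
      M X a a' = ∑ b, ∑ b', X b b' * M (Matrix.single b b' 1) a a' := by
    conv_lhs => rw [Matrix.matrix_eq_sum_single X]
    rw [← IsLinearMap.mk'_apply (lin := hM)]
    simp only [map_sum, Matrix.sum_apply]
    refine Finset.sum_congr rfl fun i _ => Finset.sum_congr rfl fun j _ => ?_
    have : Matrix.single i j (X i j) = X i j • Matrix.single i j (1 : ℂ) := by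
      simp [Matrix.smul_single]
    rw [this, map_smul]
    simp
  subst hψ
  simp only [dotProduct, mulVec, Fintype.sum_prod_type, ampliation, trFst, of_apply, ketbra,
    vecMulVec_apply, Pi.star_apply]
  simp only [h (Matrix.of _), of_apply, Finset.mul_sum, Finset.sum_mul]
  simp only [Finset.sum_comm (s := (Finset.univ : Finset R)) (t := (Finset.univ : Finset A))]
  refine Finset.sum_congr rfl fun a _ => Finset.sum_congr rfl fun a' _ =>
    Finset.sum_congr rfl fun b _ => Finset.sum_congr rfl fun b' _ => ?_
  rw [Finset.sum_comm]
  refine Finset.sum_congr rfl fun r' _ => Finset.sum_congr rfl fun r _ => ?_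
  ring

theorem canonicalPurification_purifies {A : Type*} [Fintype A] [DecidableEq A]
    {ρ : Matrix A A ℂ} (hρ : ρ.PosSemidef) :
    trFst (ketbra (canonicalPurification ρ) (canonicalPurification ρ)) = ρ := by
  conv_rhs => rw [← rpow_half_mul_self hρ]
  ext i j
  simp only [trFst, ketbra, canonicalPurification, of_apply, vecMulVec_apply, Pi.star_apply,
    Matrix.mul_apply]
  refine Finset.sum_congr rfl fun k _ => ?_
  rw [(rpow_half_isHermitian ρ).apply]

theorem star_dotProduct_of_purifies {R A : Type*} [Fintype R] [Fintype A]
    {ρ : Matrix A A ℂ} (hρ : IsState ρ) (ψ : R × A → ℂ) (hψ : trFst (ketbra ψ ψ) = ρ) :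
    star ψ ⬝ᵥ ψ = 1 := by
  rw [← hρ.2, ← hψ]
  simp only [dotProduct, Matrix.trace, diag_apply, trFst, ketbra, of_apply, vecMulVec_apply,
    Fintype.sum_prod_type_right, Pi.star_apply, mul_comm]

/-- The entanglement fidelity does not depend on the purification used to compute it, and it is
also given by `⟨ψ| (id ⊗ M)(|ψ⟩⟨ψ|) |ψ⟩`. -/
theorem entanglementFidelity_eq {R A : Type*} [Fintype R] [DecidableEq R] [Fintype A]
    [DecidableEq A] {ρ : Matrix A A ℂ} (hρ : IsState ρ) {M : Matrix A A ℂ → Matrix A A ℂ}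
    (hM : IsLinearMap ℂ M) (hcp : IsCompletelyPositive M) (ψ : R × A → ℂ)
    (hψ : trFst (ketbra ψ ψ) = ρ) :
    entanglementFidelity ρ M = fidelity (ketbra ψ ψ) (ampliation M (ketbra ψ ψ)) ^ 2 ∧
      entanglementFidelity ρ M = (star ψ ⬝ᵥ (ampliation M (ketbra ψ ψ) *ᵥ ψ)).re := by
  have hc := canonicalPurification_purifies hρ.1
  have h1 := fidelity_ketbra_sq (star_dotProduct_of_purifies hρ _ hψ)
    (ampliation_posSemidef hcp (ketbra_posSemidef ψ))
  have h2 := fidelity_ketbra_sq (star_dotProduct_of_purifies hρ _ hc)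
    (ampliation_posSemidef hcp (ketbra_posSemidef (canonicalPurification ρ)))
  rw [inner_ampliation hM ψ hψ] at *
  rw [inner_ampliation hM _ hc] at h2
  exact ⟨by rw [entanglementFidelity, h2, h1], by rw [entanglementFidelity, h2]⟩

/-! ### The Petz decoder and the twirled Petz decoder -/

/-- The Petz decoder `X ↦ ρ^(1/2) N†(N(ρ)^(-1/2) X N(ρ)^(-1/2)) ρ^(1/2)`. -/
def petzDecoder {A B : Type*} [Fintype A] [DecidableEq A] [Fintype B] [DecidableEq B]
    (ρ : Matrix A A ℂ) (N : Matrix A A ℂ → Matrix B B ℂ) (X : Matrix B B ℂ) : Matrix A A ℂ :=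
  rpow ρ (1 / 2) * adjointMap N (rpow (N ρ) (-1 / 2) * X * rpow (N ρ) (-1 / 2)) * rpow ρ (1 / 2)

/-- The rotated Petz map
`X ↦ ρ^(1/2 - it) N†(N(ρ)^(-1/2 + it) X N(ρ)^(-1/2 - it)) ρ^(1/2 + it)`. -/
def rotatedPetz {A B : Type*} [Fintype A] [DecidableEq A] [Fintype B] [DecidableEq B]
    (ρ : Matrix A A ℂ) (N : Matrix A A ℂ → Matrix B B ℂ) (t : ℝ) (X : Matrix B B ℂ) :
    Matrix A A ℂ :=
  cpow ρ (1 / 2 - Complex.I * t) *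
    adjointMap N (cpow (N ρ) (-1 / 2 + Complex.I * t) * X * cpow (N ρ) (-1 / 2 - Complex.I * t)) *
    cpow ρ (1 / 2 + Complex.I * t)

/-- The probability density `β₀(t) = (π / 2) (cosh (π t) + 1)⁻¹`. -/
def beta0 (t : ℝ) : ℝ := Real.pi / 2 * (Real.cosh (Real.pi * t) + 1)⁻¹

/-- The twirled Petz decoder `X ↦ ∫ β₀(t) R^{t/2}(X) dt`; the integral is taken entrywise. -/
def twirledPetzDecoder {A B : Type*} [Fintype A] [DecidableEq A] [Fintype B] [DecidableEq B]
    (ρ : Matrix A A ℂ) (N : Matrix A A ℂ → Matrix B B ℂ) (X : Matrix B B ℂ) : Matrix A A ℂ :=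
  Matrix.of fun i j => ∫ t : ℝ, (beta0 t : ℂ) * rotatedPetz ρ N (t / 2) X i j

/-! ### The Schumacher-Westmoreland decoder -/

/-- The first group of choices in the construction of the Schumacher-Westmoreland decoder of
`(ρ, N)`. Here `R` is `Fin ρ.rank` and `E` is `A × B`, i.e. `A ⊗ B'` with `B'` a copy of `B`. -/
structure SWPurification {A B : Type*} [Fintype A] [DecidableEq A] [Fintype B]
    (ρ : Matrix A A ℂ) (N : Matrix A A ℂ → Matrix B B ℂ) where
  /-- the probability distribution `λ` of the Schmidt decomposition -/
  lam : Fin ρ.rank → ℝ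
  lam_nonneg : ∀ k, 0 ≤ lam k
  lam_sum : ∑ k, lam k = 1
  /-- the Schmidt basis of `R` -/
  r : OrthonormalBasis (Fin ρ.rank) ℂ (EuclideanSpace ℂ (Fin ρ.rank))
  /-- the Schmidt vectors in `A` -/
  a : Fin ρ.rank → EuclideanSpace ℂ A
  a_orthonormal : Orthonormal ℂ a
  /-- `∑ k, √λ_k |r_k⟩ ⊗ |a_k⟩` is a purification of `ρ` -/
  purifies : trFst (ketbra (fun i : Fin ρ.rank × A => ∑ k, (√(lam k) : ℂ) * (r k i.1 * a k i.2))
    (fun i : Fin ρ.rank × A => ∑ k, (√(lam k) : ℂ) * (r k i.1 * a k i.2))) = ρ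
  /-- the Stinespring isometry `A → B ⊗ E` of `N` -/
  V : Matrix (B × (A × B)) A ℂ
  V_isometry : Vᴴ * V = 1
  V_dilates : ∀ X, N X = trSnd (V * X * Vᴴ)

namespace SWPurification

variable {A B : Type*} [Fintype A] [DecidableEq A] [Fintype B] {ρ : Matrix A A ℂ}
  {N : Matrix A A ℂ → Matrix B B ℂ} (P : SWPurification ρ N)

/-- The vector `|ρ⟩_{RA} = ∑ k, √λ_k |r_k⟩ ⊗ |a_k⟩`. -/
def rhoVec : Fin ρ.rank × A → ℂ :=
  fun i => ∑ k, (√(P.lam k) : ℂ) * (P.r k i.1 * P.a k i.2)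

/-- The vector `|σ⟩_{RBE} = V |ρ⟩_{RA}`. -/
def sigmaVec : (Fin ρ.rank × B) × (A × B) → ℂ :=
  fun i => ∑ a, P.V (i.1.2, i.2) a * P.rhoVec (i.1.1, a)

/-- The state `σ_{RE}`. -/
def sigmaRE : Matrix (Fin ρ.rank × (A × B)) (Fin ρ.rank × (A × B)) ℂ :=
  trMid (ketbra P.sigmaVec P.sigmaVec)

/-- The state `σ_R`. -/
def sigmaR : Matrix (Fin ρ.rank) (Fin ρ.rank) ℂ := trSnd P.sigmaRE

/-- The state `σ_E`. -/
def sigmaE : Matrix (A × B) (A × B) ℂ := trFst P.sigmaRE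

end SWPurification

/-- The second group of choices: a spectral decomposition of `σ_E`. -/
structure SWSpectral {A B : Type*} [Fintype A] [DecidableEq A] [Fintype B] [DecidableEq B]
    (ρ : Matrix A A ℂ) (N : Matrix A A ℂ → Matrix B B ℂ) extends SWPurification ρ N where
  /-- the eigenvalues of `σ_E` -/
  mu : A × B → ℝ
  mu_nonneg : ∀ l, 0 ≤ mu l
  mu_sum : ∑ l, mu l = 1
  /-- the eigenbasis of `σ_E` -/
  e : OrthonormalBasis (A × B) ℂ (EuclideanSpace ℂ (A × B))
  spectral : toSWPurification.sigmaE = ∑ l, (mu l : ℂ) • ketbra (e l) (e l)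

namespace SWSpectral

variable {A B : Type*} [Fintype A] [DecidableEq A] [Fintype B] [DecidableEq B]
  {ρ : Matrix A A ℂ} {N : Matrix A A ℂ → Matrix B B ℂ} (S : SWSpectral ρ N)

/-- The product basis `|r_k⟩ ⊗ |e_l⟩` of `R ⊗ E`. The same vectors, in the copies `R'` of `R` and
`E' = A' ⊗ B` of `E`, are the vectors `|φ_{k,l}⟩` of `R' ⊗ E'`. -/
def phi (k : Fin ρ.rank) (l : A × B) : Fin ρ.rank × (A × B) → ℂ :=
  fun y => S.r k y.1 * S.e l y.2

/-- The operator `σ̂^{1/2} σ_{RE}^{1/2}` with `σ̂ = σ_R ⊗ σ_E`. -/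
def rootProduct : Matrix (Fin ρ.rank × (A × B)) (Fin ρ.rank × (A × B)) ℂ :=
  rpow (S.sigmaR ⊗ₖ S.sigmaE) (1 / 2) * rpow S.sigmaRE (1 / 2)

/-- The vector `|Ψ^σ⟩ = σ_{RE}^{1/2} ∑ k l, |r_k⟩ ⊗ |e_l⟩ ⊗ |r_k⟩ ⊗ |e_l⟩` in
`(R ⊗ E) ⊗ (R' ⊗ E')`. -/
def psiVec : (Fin ρ.rank × (A × B)) × (Fin ρ.rank × (A × B)) → ℂ :=
  fun i => ∑ k, ∑ l, (rpow S.sigmaRE (1 / 2) *ᵥ S.phi k l) i.1 * S.phi k l i.2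

/-- The operator `M` on `R' ⊗ E'`, the transpose of `σ̂^{1/2} σ_{RE}^{1/2}` in the basis
`|r_k⟩ ⊗ |e_l⟩`. -/
def opM : Matrix (Fin ρ.rank × (A × B)) (Fin ρ.rank × (A × B)) ℂ :=
  ∑ k, ∑ j, ∑ m, ∑ n, (star (S.phi k m) ⬝ᵥ (S.rootProduct *ᵥ S.phi j n)) •
    ketbra (S.phi j n) (S.phi k m)

end SWSpectral

/-- All choices in the construction of the Schumacher-Westmoreland decoder of `(ρ, N)`: in
addition to the previous ones, a singular value decomposition of `M`, a unit vector `|0⟩` of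
`R' ⊗ A'`, and a unitary `W` of `R' ⊗ E'` with `|Ψ^σ⟩ = W (|σ⟩ ⊗ |0⟩)`. -/
structure SWConstruction {A B : Type*} [Fintype A] [DecidableEq A] [Fintype B] [DecidableEq B]
    (ρ : Matrix A A ℂ) (N : Matrix A A ℂ → Matrix B B ℂ) extends SWSpectral ρ N where
  /-- the left unitary of the singular value decomposition -/
  Uhat : Matrix (Fin ρ.rank × (A × B)) (Fin ρ.rank × (A × B)) ℂ
  Uhat_unitary : Uhat ∈ Matrix.unitaryGroup (Fin ρ.rank × (A × B)) ℂ
  /-- the right unitary of the singular value decomposition -/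
  Utilde : Matrix (Fin ρ.rank × (A × B)) (Fin ρ.rank × (A × B)) ℂ
  Utilde_unitary : Utilde ∈ Matrix.unitaryGroup (Fin ρ.rank × (A × B)) ℂ
  /-- the singular values -/
  s : Fin ρ.rank → A × B → ℝ
  s_nonneg : ∀ k l, 0 ≤ s k l
  svd : toSWSpectral.opM = Uhat *
    (∑ k, ∑ l, (s k l : ℂ) • ketbra (toSWSpectral.phi k l) (toSWSpectral.phi k l)) * Utilde
  /-- the unit vector `|0⟩` of `R' ⊗ A'` -/
  zero : Fin ρ.rank × A → ℂ
  zero_unit : star zero ⬝ᵥ zero = 1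
  /-- the unitary `W` -/
  W : Matrix (Fin ρ.rank × (A × B)) (Fin ρ.rank × (A × B)) ℂ
  W_unitary : W ∈ Matrix.unitaryGroup (Fin ρ.rank × (A × B)) ℂ
  W_spec : ∀ x y, toSWSpectral.psiVec (x, y) = (W *ᵥ fun y' : Fin ρ.rank × (A × B) =>
    toSWPurification.sigmaVec ((x.1, y'.2.2), x.2) * zero (y'.1, y'.2.1)) y

namespace SWConstruction

variable {A B : Type*} [Fintype A] [DecidableEq A] [Fintype B] [DecidableEq B]
  {ρ : Matrix A A ℂ} {N : Matrix A A ℂ → Matrix B B ℂ} (C : SWConstruction ρ N)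

/-- The unitary `U = Ũ† Û†`. -/
def opU : Matrix (Fin ρ.rank × (A × B)) (Fin ρ.rank × (A × B)) ℂ := C.Utildeᴴ * C.Uhatᴴ

/-- The embedding `X ↦ X ⊗ |0⟩⟨0|` of operators on `B` into operators on `R' ⊗ (A' ⊗ B)`. -/
def embed (X : Matrix B B ℂ) : Matrix (Fin ρ.rank × (A × B)) (Fin ρ.rank × (A × B)) ℂ :=
  Matrix.of fun y y' => X y.2.2 y'.2.2 * ketbra C.zero C.zero (y.1, y.2.1) (y'.1, y'.2.1)

/-- The Kraus operators `K_l = ∑ k, |a_k⟩⟨φ_{k,l}| U W`. -/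
def kraus (l : A × B) : Matrix A (Fin ρ.rank × (A × B)) ℂ :=
  ∑ k, ketbra (C.a k) (C.phi k l) * C.opU * C.W

/-- The Schumacher-Westmoreland decoder. -/
def decoder (X : Matrix B B ℂ) : Matrix A A ℂ :=
  ∑ l, C.kraus l * C.embed X * (C.kraus l)ᴴ

end SWConstruction

end

end QRecovery

open QRecovery

namespace QRecovery

noncomputable section

set_option linter.unusedSectionVars false

/-! ### Functional calculus of Hermitian matrices -/

section FunctionalCalculus

variable {m n : Type*} [Fintype m] [DecidableEq m] [Fintype n] [DecidableEq n]

/-! Everything is tied to decoupling: for a pure vector on `R ⊗ B ⊗ E` that extends `σ_{RB}`, the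
reference `R` must be uncorrelated with the environment `E`.

Recovery forces decoupling (`trMid_eq_kronecker_of_recovery`). Applying a perfect decoder to `B`
produces a state on `R ⊗ A ⊗ E` whose `RA` marginal is pure. A state with a pure marginal is a
product, and discarding `A` preserves the product form.

Decoupling is the entropy condition (`condEntropy_eq_iff`). Complementary marginals of a pure vector
have equal entropy, so `H(R|B) = H(R|A)` becomes `H(RE) = H(R) + H(E)`. This is the equality case of
subadditivity, obtained from the equality case of Klein's inequality. The condition depends on the
purification only through `ρ`.

Decoupling makes each explicit decoder work. For the rotated Petz maps (`ampliation_rotatedPetz`),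
let `L` be the row of blocks `K_e ρ^{1/2}`. Then `L Lᴴ = N(ρ)`, while `Lᴴ L` is the transposed state
of `RE`, hence `ρ ⊗ γ`. Since `L` intertwines functions of the two, `Lᴴ N(ρ)^w L = ρ^{1+w} ⊗
γ^{1+w}`, and for `w = -1/2 + it` its blocks say that every Kraus operator of decoder after channel
acts on the purification as a scalar. Averaging over `t` gives the twirled decoder. For the
Schumacher-Westmoreland decoder (`ampliation_decoder`), decoupling makes `M` positive, so the
unitary `U` from its singular value decomposition fixes the range of `M`. What remains is a
purification of `σ_R ⊗ σ_E`, from which the `|a_k⟩` are rebuilt.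

Conversely, the Schumacher-Westmoreland decoder is a channel. The Petz decoders preserve the trace
only on the support of `N(ρ)`, and `exists_channel_of_recovery` completes them to channels. -/

theorem exists_polynomial_eqOn {s : Set ℝ} (hs : s.Finite) (f : ℝ → ℝ) :
    ∃ p : Polynomial ℝ, ∀ x ∈ s, f x = p.eval x := by
  refine ⟨Lagrange.interpolate hs.toFinset id f, fun x hx => ?_⟩
  have := Lagrange.eval_interpolate_at_node (v := id) (i := x) (s := hs.toFinset) f
    Function.injective_id.injOn (by simpa using hx)
  simpa using this.symm

theorem cfc_eq_aeval {X : Matrix m m ℂ} (hX : X.IsHermitian) {f : ℝ → ℝ} {p : Polynomial ℝ}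
    (h : ∀ x ∈ spectrum ℝ X, f x = p.eval x) : cfc f X = Polynomial.aeval X p := by
  have hX' : IsSelfAdjoint X := hX
  rw [cfc_congr (g := p.eval) h, cfc_polynomial p X hX']

theorem aeval_mul_of_intertwine {X : Matrix m m ℂ} {Y : Matrix n n ℂ} {Z : Matrix m n ℂ}
    (h : X * Z = Z * Y) (p : Polynomial ℝ) :
    Polynomial.aeval X p * Z = Z * Polynomial.aeval Y p := by
  induction p using Polynomial.induction_on' with
  | add p q hp hq => simp [Matrix.add_mul, Matrix.mul_add, hp, hq]
  | monomial k a =>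
    have hk : X ^ k * Z = Z * Y ^ k := by
      induction k with
      | zero => simp
      | succ k ih => rw [pow_succ, Matrix.mul_assoc, h, ← Matrix.mul_assoc, ih, pow_succ,
          Matrix.mul_assoc]
    simp [Polynomial.aeval_monomial, Algebra.algebraMap_eq_smul_one, hk]

/-- A single polynomial interpolates `f` on both finite spectra, and polynomials pass through `Z`.
Since `Z` may be rectangular and singular, this exchanges functions of `M * Mᴴ` and `Mᴴ * M`. -/
theorem cfc_mul_of_intertwine {X : Matrix m m ℂ} {Y : Matrix n n ℂ} {Z : Matrix m n ℂ}
    (hX : X.IsHermitian) (hY : Y.IsHermitian) (h : X * Z = Z * Y) (f : ℝ → ℝ) :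
    cfc f X * Z = Z * cfc f Y := by
  obtain ⟨p, hp⟩ := exists_polynomial_eqOn
    ((finite_real_spectrum (A := X)).union (finite_real_spectrum (A := Y))) f
  rw [cfc_eq_aeval hX fun x hx => hp x (.inl hx), cfc_eq_aeval hY fun x hx => hp x (.inr hx),
    aeval_mul_of_intertwine h]

theorem aeval_transpose (X : Matrix m m ℂ) (p : Polynomial ℝ) :
    Polynomial.aeval Xᵀ p = (Polynomial.aeval X p)ᵀ := by
  induction p using Polynomial.induction_on' with
  | add p q hp hq => simp [hp, hq]
  | monomial k a => simp [Polynomial.aeval_monomial, Algebra.algebraMap_eq_smul_one]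

theorem cfc_transpose {X : Matrix m m ℂ} (hX : X.IsHermitian) (f : ℝ → ℝ) :
    cfc f Xᵀ = (cfc f X)ᵀ := by
  obtain ⟨p, hp⟩ := exists_polynomial_eqOn
    ((finite_real_spectrum (A := X)).union (finite_real_spectrum (A := Xᵀ))) f
  rw [cfc_eq_aeval hX fun x hx => hp x (.inl hx),
    cfc_eq_aeval hX.transpose fun x hx => hp x (.inr hx), aeval_transpose]

theorem isHermitian_diagonal_ofReal {m : Type*} [DecidableEq m] (d : m → ℝ) :
    (diagonal fun i => (d i : ℂ)).IsHermitian := by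
  simp [Matrix.IsHermitian, diagonal_conjTranspose, Pi.star_def]

theorem aeval_diagonal (d : m → ℝ) (p : Polynomial ℝ) :
    Polynomial.aeval (diagonal fun i => (d i : ℂ)) p = diagonal fun i => ((p.eval (d i) : ℝ) : ℂ) := by
  induction p using Polynomial.induction_on' with
  | add p q hp hq => simp [hp, hq]
  | monomial k a =>
    ext i j
    by_cases h : i = j
    · subst h; simp [Polynomial.aeval_monomial, Algebra.algebraMap_eq_smul_one, diagonal_pow]
    · simp [Polynomial.aeval_monomial, Algebra.algebraMap_eq_smul_one, diagonal_pow, h]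

theorem cfc_diagonal (d : m → ℝ) (f : ℝ → ℝ) :
    cfc f (diagonal fun i => (d i : ℂ)) = diagonal fun i => (f (d i) : ℂ) := by
  -- Interpolating on the range of `d` as well avoids identifying it with the spectrum.
  obtain ⟨p, hp⟩ := exists_polynomial_eqOn
    ((finite_real_spectrum (A := diagonal fun i => (d i : ℂ))).union (Set.finite_range d)) f
  rw [cfc_eq_aeval (isHermitian_diagonal_ofReal d) fun x hx => hp x (.inl hx), aeval_diagonal]
  simp_rw [hp _ (.inr (Set.mem_range_self _))]

/-- `U * diag d * Uᴴ` for a unitary `U`. -/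
def conjDiag (U : Matrix m m ℂ) (d : m → ℂ) : Matrix m m ℂ := U * diagonal d * Uᴴ

theorem unitary_conjTranspose_mul {U : Matrix m m ℂ} (hU : U ∈ unitaryGroup m ℂ) : Uᴴ * U = 1 :=
  mem_unitaryGroup_iff'.1 hU

theorem unitary_mul_conjTranspose {U : Matrix m m ℂ} (hU : U ∈ unitaryGroup m ℂ) : U * Uᴴ = 1 :=
  mem_unitaryGroup_iff.1 hU

theorem mem_unitaryGroup_of_conjTranspose_mul {U : Matrix m m ℂ} (h : Uᴴ * U = 1) :
    U ∈ unitaryGroup m ℂ :=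
  mem_unitaryGroup_iff'.2 h

theorem conjTranspose_mem_unitaryGroup {U : Matrix m m ℂ} (hU : U ∈ unitaryGroup m ℂ) :
    Uᴴ ∈ unitaryGroup m ℂ :=
  mem_unitaryGroup_iff.2 (by simpa [star_eq_conjTranspose] using unitary_conjTranspose_mul hU)

theorem transpose_mem_unitaryGroup {U : Matrix m m ℂ} (hU : U ∈ unitaryGroup m ℂ) :
    Uᵀ ∈ unitaryGroup m ℂ := by
  refine mem_unitaryGroup_iff.2 ?_
  have := congrArg transpose (unitary_conjTranspose_mul hU)
  rw [transpose_mul, transpose_one] at this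
  exact this

theorem conjDiag_mul {U : Matrix m m ℂ} (hU : U ∈ unitaryGroup m ℂ) (d : m → ℂ) :
    conjDiag U d * U = U * diagonal d := by
  rw [conjDiag, Matrix.mul_assoc, unitary_conjTranspose_mul hU, Matrix.mul_one]

theorem conjDiag_mul_conjDiag {U : Matrix m m ℂ} (hU : U ∈ unitaryGroup m ℂ) (d e : m → ℂ) :
    conjDiag U d * conjDiag U e = conjDiag U fun i => d i * e i := by
  conv_lhs => rw [conjDiag.eq_1 U e, ← Matrix.mul_assoc, ← Matrix.mul_assoc, conjDiag_mul hU]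
  rw [Matrix.mul_assoc U, diagonal_mul_diagonal, conjDiag]

theorem conjDiag_conjTranspose (U : Matrix m m ℂ) (d : m → ℂ) :
    (conjDiag U d)ᴴ = conjDiag U (star d) := by
  simp [conjDiag, Matrix.mul_assoc, diagonal_conjTranspose]

theorem conjDiag_isHermitian (U : Matrix m m ℂ) (d : m → ℝ) :
    (conjDiag U fun i => (d i : ℂ)).IsHermitian := by
  rw [Matrix.IsHermitian, conjDiag_conjTranspose]
  simp [Pi.star_def]

theorem conjDiag_posSemidef (U : Matrix m m ℂ) {d : m → ℝ} (hd : ∀ i, 0 ≤ d i) :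
    (conjDiag U fun i => (d i : ℂ)).PosSemidef := by
  refine PosSemidef.mul_mul_conjTranspose_same (PosSemidef.diagonal ?_) U
  intro i
  simpa using hd i

theorem trace_conjDiag {U : Matrix m m ℂ} (hU : U ∈ unitaryGroup m ℂ) (d : m → ℂ) :
    (conjDiag U d).trace = ∑ i, d i := by
  rw [conjDiag, trace_mul_comm, ← Matrix.mul_assoc, unitary_conjTranspose_mul hU, Matrix.one_mul,
    trace_diagonal]

theorem cfc_conjDiag {U : Matrix m m ℂ} (hU : U ∈ unitaryGroup m ℂ) (d : m → ℝ) (f : ℝ → ℝ) :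
    cfc f (conjDiag U fun i => (d i : ℂ)) = conjDiag U fun i => (f (d i) : ℂ) := by
  have := cfc_mul_of_intertwine (conjDiag_isHermitian U d) (isHermitian_diagonal_ofReal d)
    (conjDiag_mul hU _) f
  rw [cfc_diagonal] at this
  rw [conjDiag.eq_1 U fun i => (f (d i) : ℂ), ← this, Matrix.mul_assoc,
    unitary_mul_conjTranspose hU, Matrix.mul_one]

theorem exists_conjDiag {X : Matrix m m ℂ} (hX : X.IsHermitian) :
    ∃ U ∈ unitaryGroup m ℂ, ∃ d : m → ℝ, X = conjDiag U fun i => (d i : ℂ) :=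
  ⟨hX.eigenvectorUnitary, hX.eigenvectorUnitary.2, hX.eigenvalues, by
    conv_lhs => rw [hX.spectral_theorem, Unitary.conjStarAlgAut_apply]
    rfl⟩

theorem diag_eq_of_conjDiag {U : Matrix m m ℂ} (hU : U ∈ unitaryGroup m ℂ) (d : m → ℂ) :
    Uᴴ * conjDiag U d * U = diagonal d := by
  rw [Matrix.mul_assoc, conjDiag_mul hU, ← Matrix.mul_assoc, unitary_conjTranspose_mul hU,
    Matrix.one_mul]

theorem nonneg_of_conjDiag_posSemidef {U : Matrix m m ℂ} (hU : U ∈ unitaryGroup m ℂ) {d : m → ℝ}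
    (h : (conjDiag U fun i => (d i : ℂ)).PosSemidef) (i : m) : 0 ≤ d i := by
  have := (h.conjTranspose_mul_mul_same U).diag_nonneg (i := i)
  rw [diag_eq_of_conjDiag hU] at this
  simpa using this

theorem exists_conjDiag_nonneg {X : Matrix m m ℂ} (hX : X.PosSemidef) :
    ∃ U ∈ unitaryGroup m ℂ, ∃ d : m → ℝ, (∀ i, 0 ≤ d i) ∧ X = conjDiag U fun i => (d i : ℂ) := by
  obtain ⟨U, hU, d, rfl⟩ := exists_conjDiag hX.1
  exact ⟨U, hU, d, nonneg_of_conjDiag_posSemidef hU hX, rfl⟩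

/-- The eigenvalues of `X ^ z`, as a function of the eigenvalues of `X`. -/
def suppCpow (z : ℂ) (x : ℝ) : ℂ := if x = 0 then 0 else (x : ℂ) ^ z

theorem cpow_conjDiag {U : Matrix m m ℂ} (hU : U ∈ unitaryGroup m ℂ) (d : m → ℝ) (z : ℂ) :
    cpow (conjDiag U fun i => (d i : ℂ)) z = conjDiag U fun i => suppCpow z (d i) := by
  have h1 : diagonal (fun i => suppCpow z (d i)) =
      diagonal (fun i => (((if d i = 0 then 0 else ((d i : ℂ) ^ z).re : ℝ)) : ℂ)) +
      Complex.I • diagonal (fun i => (((if d i = 0 then 0 else ((d i : ℂ) ^ z).im : ℝ)) : ℂ)) := by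
    rw [← diagonal_smul, diagonal_add]
    congr 1
    funext i
    by_cases h : d i = 0
    · simp [suppCpow, h]
    · simp only [suppCpow, h, if_false, Pi.smul_apply, smul_eq_mul]
      rw [mul_comm, Complex.re_add_im]
  rw [cpow, cfc_conjDiag hU, cfc_conjDiag hU]
  simp only [conjDiag, h1, Matrix.mul_add, Matrix.add_mul, Matrix.mul_smul, Matrix.smul_mul]

theorem cpow_mul_of_intertwine {X : Matrix m m ℂ} {Y : Matrix n n ℂ} {Z : Matrix m n ℂ}
    (hX : X.IsHermitian) (hY : Y.IsHermitian) (h : X * Z = Z * Y) (z : ℂ) :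
    cpow X z * Z = Z * cpow Y z := by
  simp only [cpow, Matrix.add_mul, Matrix.mul_add, Matrix.smul_mul, Matrix.mul_smul,
    cfc_mul_of_intertwine hX hY h]

/-- At `x = 0` both sides vanish, so the exponent law holds without exception. Consequently `cpow X
0` is the support projection, not the identity. -/
theorem suppCpow_mul (z w : ℂ) (x : ℝ) :
    suppCpow z x * suppCpow w x = suppCpow (z + w) x := by
  by_cases h : x = 0
  · simp [suppCpow, h]
  · simp [suppCpow, h, Complex.cpow_add _ _ (Complex.ofReal_ne_zero.2 h)]

theorem cpow_mul_cpow {X : Matrix m m ℂ} (hX : X.IsHermitian) (z w : ℂ) :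
    cpow X z * cpow X w = cpow X (z + w) := by
  obtain ⟨U, hU, d, rfl⟩ := exists_conjDiag hX
  simp only [cpow_conjDiag hU, conjDiag_mul_conjDiag hU, suppCpow_mul]

theorem cpow_one {X : Matrix m m ℂ} (hX : X.IsHermitian) : cpow X 1 = X := by
  obtain ⟨U, hU, d, rfl⟩ := exists_conjDiag hX
  rw [cpow_conjDiag hU]
  congr 1
  funext i
  by_cases h : d i = 0 <;> simp [suppCpow, h]

theorem cpow_conjTranspose {X : Matrix m m ℂ} (hX : X.PosSemidef) (z : ℂ) :
    (cpow X z)ᴴ = cpow X (star z) := by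
  obtain ⟨U, hU, d, hd, rfl⟩ := exists_conjDiag_nonneg hX
  rw [cpow_conjDiag hU, cpow_conjDiag hU, conjDiag_conjTranspose]
  congr 1
  funext i
  by_cases h : d i = 0
  · simp [suppCpow, h]
  · simp only [suppCpow, h, Pi.star_apply, if_false]
    -- Conjugation commutes with the principal branch off the negative axis; this is where
    -- positivity of `X` enters.
    have := Complex.cpow_conj (d i : ℂ) (star z)
      (by rw [Complex.arg_ofReal_of_nonneg (hd i)]; exact Real.pi_pos.ne)
    simp only [Complex.conj_ofReal] at this
    rw [starRingEnd_apply, starRingEnd_apply, star_star] at this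
    rw [this, star_star]

theorem rpow_eq_cpow {X : Matrix m m ℂ} (hX : X.PosSemidef) (p : ℝ) : rpow X p = cpow X p := by
  obtain ⟨U, hU, d, hd, rfl⟩ := exists_conjDiag_nonneg hX
  rw [cpow_conjDiag hU, rpow, cfc_conjDiag hU]
  congr 1
  funext i
  by_cases h : d i = 0
  · simp [suppCpow, h]
  · simp [suppCpow, h, Complex.ofReal_cpow (hd i)]

theorem conjDiag_kronecker (U : Matrix m m ℂ) (V : Matrix n n ℂ) (d : m → ℂ) (c : n → ℂ) :
    conjDiag U d ⊗ₖ conjDiag V c = conjDiag (U ⊗ₖ V) fun i => d i.1 * c i.2 := by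
  simp [conjDiag, mul_kronecker_mul, conjTranspose_kronecker, diagonal_kronecker_diagonal]

theorem kronecker_mem_unitaryGroup {U : Matrix m m ℂ} {V : Matrix n n ℂ}
    (hU : U ∈ unitaryGroup m ℂ) (hV : V ∈ unitaryGroup n ℂ) :
    U ⊗ₖ V ∈ unitaryGroup (m × n) ℂ :=
  Matrix.kronecker_mem_unitary hU hV

theorem cpow_kronecker {X : Matrix m m ℂ} {Y : Matrix n n ℂ} (hX : X.PosSemidef)
    (hY : Y.PosSemidef) (z : ℂ) : cpow (X ⊗ₖ Y) z = cpow X z ⊗ₖ cpow Y z := by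
  obtain ⟨U, hU, d, hd, rfl⟩ := exists_conjDiag_nonneg hX
  obtain ⟨V, hV, c, hc, rfl⟩ := exists_conjDiag_nonneg hY
  rw [cpow_conjDiag hU, cpow_conjDiag hV, conjDiag_kronecker, conjDiag_kronecker]
  simp only [← Complex.ofReal_mul]
  rw [cpow_conjDiag (kronecker_mem_unitaryGroup hU hV) fun i => d i.1 * c i.2]
  congr 1
  funext i
  by_cases h : d i.1 = 0
  · simp [suppCpow, h]
  by_cases h' : c i.2 = 0
  · simp [suppCpow, h']
  · simp [suppCpow, h, h', Complex.mul_cpow_ofReal_nonneg (hd i.1) (hc i.2)]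

theorem eq_of_mul_self_eq {X Y : Matrix m m ℂ} (hX : X.PosSemidef) (hY : Y.PosSemidef)
    (h : X * X = Y * Y) : X = Y := by
  rw [← rpow_half_of_mul_self hX, h, rpow_half_of_mul_self hY]

/-! ### Singular value decomposition -/

/-- The columns of `Y` are orthogonal with norms `√(d i)`. The nonzero ones are normalised and
extended to an orthonormal basis; the others vanish, so their replacements are harmless. -/
theorem exists_unitary_mul_diagonal {Y : Matrix m m ℂ} {d : m → ℝ} (hd : ∀ i, 0 ≤ d i)
    (h : Yᴴ * Y = diagonal fun i => (d i : ℂ)) :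
    ∃ Z ∈ unitaryGroup m ℂ, Y = Z * diagonal fun i => (√(d i) : ℂ) := by
  let v : m → EuclideanSpace ℂ m := fun i => WithLp.toLp 2 fun j => Y j i / (√(d i) : ℂ)
  have hin (i j : m) : ∑ k, Y k j * star (Y k i) = if i = j then (d i : ℂ) else 0 := by
    have := congrFun (congrFun h i) j
    simp only [mul_apply, conjTranspose_apply, diagonal_apply] at this
    rw [← this]
    exact Finset.sum_congr rfl fun k _ => mul_comm _ _
  have hv : Orthonormal ℂ ({i | d i ≠ 0}.domRestrict v) := by
    rw [orthonormal_iff_ite]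
    rintro ⟨i, hi⟩ ⟨j, hj⟩
    have hi' : (√(d i) : ℂ) ≠ 0 := by
      simpa [Real.sqrt_eq_zero (hd i)] using hi
    have hsum : inner ℂ (v i) (v j) =
        (∑ k, Y k j * star (Y k i)) / ((√(d i) : ℂ) * (√(d j) : ℂ)) := by
      simp only [v, PiLp.inner_apply, RCLike.inner_apply, map_div₀, Complex.conj_ofReal,
        Finset.sum_div]
      refine Finset.sum_congr rfl fun k _ => ?_
      rw [div_mul_div_comm, mul_comm (√(d j) : ℂ)]
      rfl
    simp only [Set.domRestrict_apply, hsum, hin, Subtype.mk.injEq]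
    split_ifs with hij
    · subst hij
      rw [← Complex.ofReal_mul, Real.mul_self_sqrt (hd i)]
      exact div_self (by exact_mod_cast hi)
    · simp
  obtain ⟨b, hb⟩ := hv.exists_orthonormalBasis_extension_of_card_eq (by simp)
  refine ⟨Matrix.of fun i j => b j i, mem_unitaryGroup_of_conjTranspose_mul ?_, ?_⟩
  · ext i j
    have := orthonormal_iff_ite.1 b.orthonormal i j
    simp only [PiLp.inner_apply, RCLike.inner_apply] at this
    simp only [mul_apply, conjTranspose_apply, of_apply, one_apply, ← this]
    exact Finset.sum_congr rfl fun k _ => mul_comm _ _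
  · ext i j
    rw [mul_diagonal, of_apply]
    by_cases hj : d j = 0
    · have := hin j j
      rw [if_pos rfl, hj] at this
      have h0 : ∑ k, ‖Y k j‖ ^ 2 = 0 := by
        have h1 : ∑ k, Y k j * star (Y k j) = ((∑ k, ‖Y k j‖ ^ 2 : ℝ) : ℂ) := by
          push_cast
          exact Finset.sum_congr rfl fun k _ => Complex.mul_conj' _
        rw [h1] at this
        exact_mod_cast this
      have h2 := (Finset.sum_eq_zero_iff_of_nonneg fun k _ => by positivity).1 h0 i
        (Finset.mem_univ _)
      simpa [hj] using h2
    · rw [hb j hj]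
      have hj' : (√(d j) : ℂ) ≠ 0 := by simpa [Real.sqrt_eq_zero (hd j)] using hj
      simp [v, div_mul_cancel₀ _ hj']

theorem exists_svd (X : Matrix m m ℂ) : ∃ Z ∈ unitaryGroup m ℂ, ∃ V ∈ unitaryGroup m ℂ,
    ∃ s : m → ℝ, (∀ i, 0 ≤ s i) ∧ X = Z * (diagonal fun i => (s i : ℂ)) * V := by
  obtain ⟨V, hV, d, hd, h⟩ := exists_conjDiag_nonneg (posSemidef_conjTranspose_mul_self X)
  obtain ⟨Z, hZ, h'⟩ := exists_unitary_mul_diagonal (Y := X * V) hd (by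
    rw [conjTranspose_mul, Matrix.mul_assoc, ← Matrix.mul_assoc Xᴴ, h, ← Matrix.mul_assoc,
      diag_eq_of_conjDiag hV])
  refine ⟨Z, hZ, Vᴴ, conjTranspose_mem_unitaryGroup hV, fun i => √(d i),
    fun i => Real.sqrt_nonneg _, ?_⟩
  rw [← h', Matrix.mul_assoc, unitary_mul_conjTranspose hV, Matrix.mul_one]

/-- After diagonalising the common Gram matrix, both operators are a unitary times the same
diagonal. This is the uniqueness of purifications up to a unitary, and it provides `W`. -/
theorem exists_unitary_of_conjTranspose_mul_eq {X Y : Matrix m m ℂ} (h : Xᴴ * X = Yᴴ * Y) :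
    ∃ U ∈ unitaryGroup m ℂ, X = U * Y := by
  obtain ⟨V, hV, d, hd, hX⟩ := exists_conjDiag_nonneg (posSemidef_conjTranspose_mul_self X)
  have key (T : Matrix m m ℂ) (hT : Tᴴ * T = Xᴴ * X) :
      ∃ Z ∈ unitaryGroup m ℂ, T * V = Z * diagonal fun i => (√(d i) : ℂ) :=
    exists_unitary_mul_diagonal (Y := T * V) hd (by
      rw [conjTranspose_mul, Matrix.mul_assoc, ← Matrix.mul_assoc Tᴴ, hT, hX, ← Matrix.mul_assoc,
        diag_eq_of_conjDiag hV])
  obtain ⟨Z, hZ, h1⟩ := key X rfl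
  obtain ⟨Z', hZ', h2⟩ := key Y h.symm
  refine ⟨Z * Z'ᴴ, mul_mem hZ (conjTranspose_mem_unitaryGroup hZ'), ?_⟩
  have h3 : X * V = Z * Z'ᴴ * Y * V := by
    rw [Matrix.mul_assoc _ Y, h2, Matrix.mul_assoc Z, ← Matrix.mul_assoc Z'ᴴ,
      unitary_conjTranspose_mul hZ', Matrix.one_mul, h1]
  have := congrArg (· * Vᴴ) h3
  simpa [Matrix.mul_assoc, unitary_mul_conjTranspose hV] using this

end FunctionalCalculus

/-! ### Kraus maps -/

section Kraus

variable {A B C R ι κ : Type*} [Fintype A] [Fintype B] [Fintype C] [Fintype R]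
  [Fintype ι] [Fintype κ]

/-- The completely positive map `X ↦ ∑ e, K_e X K_eᴴ`. -/
def krausMap {A B ι : Type*} [Fintype A] [Fintype ι] (K : ι → Matrix B A ℂ) (X : Matrix A A ℂ) :
    Matrix B B ℂ :=
  ∑ e, K e * X * (K e)ᴴ

theorem krausMap_apply {A B ι : Type*} [Fintype A] [Fintype ι] (K : ι → Matrix B A ℂ)
    (X : Matrix A A ℂ) (b b' : B) :
    krausMap K X b b' = ∑ e, ∑ a, ∑ a', K e b a * X a a' * star (K e b' a') := by
  simp only [krausMap, Matrix.sum_apply, mul_apply, conjTranspose_apply, Finset.sum_mul]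
  exact Finset.sum_congr rfl fun e _ => Finset.sum_comm

theorem krausMap_isLinearMap {A B ι : Type*} [Fintype A] [Fintype ι] (K : ι → Matrix B A ℂ) :
    IsLinearMap ℂ (krausMap K) where
  map_add X Y := by simp [krausMap, Matrix.mul_add, Matrix.add_mul, Finset.sum_add_distrib]
  map_smul c X := by simp [krausMap, Finset.smul_sum]

theorem krausMap_isCompletelyPositive (K : ι → Matrix B A ℂ) :
    IsCompletelyPositive (krausMap K) := by
  intro n X hX
  have h : ampliation (krausMap K) X =
      ∑ e, ((1 : Matrix (Fin n) (Fin n) ℂ) ⊗ₖ K e) * X * ((1 : Matrix (Fin n) (Fin n) ℂ) ⊗ₖ K e)ᴴ := by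
    ext ⟨r, b⟩ ⟨r', b'⟩
    simp only [ampliation, of_apply, krausMap_apply, Matrix.sum_apply]
    refine Finset.sum_congr rfl fun e _ => ?_
    simp only [mul_apply, conjTranspose_apply, kroneckerMap_apply, Fintype.sum_prod_type,
      one_apply, ite_mul, one_mul, zero_mul, apply_ite star, star_zero,
      Finset.sum_mul, mul_ite, mul_zero]
    rw [Finset.sum_comm]
    refine (Finset.sum_congr rfl fun a' _ => ?_).trans (Finset.sum_comm)
    simp
  rw [h]
  exact posSemidef_sum _ fun e _ => hX.mul_mul_conjTranspose_same _

theorem trace_krausMap [DecidableEq A] (K : ι → Matrix B A ℂ) (X : Matrix A A ℂ) :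
    (krausMap K X).trace = ((∑ e, (K e)ᴴ * K e) * X).trace := by
  simp only [krausMap, trace_sum, Finset.sum_mul]
  refine Finset.sum_congr rfl fun e _ => ?_
  rw [trace_mul_comm, ← Matrix.mul_assoc]

theorem krausMap_isChannel [DecidableEq A] {K : ι → Matrix B A ℂ} (h : ∑ e, (K e)ᴴ * K e = 1) :
    IsChannel (krausMap K) :=
  ⟨krausMap_isLinearMap K, krausMap_isCompletelyPositive K, fun X => by
    rw [trace_krausMap, h, Matrix.one_mul]⟩

theorem krausMap_comp (K : ι → Matrix C B ℂ) (L : κ → Matrix B A ℂ) :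
    krausMap K ∘ krausMap L = krausMap fun i : ι × κ => K i.1 * L i.2 := by
  funext X
  simp only [Function.comp, krausMap, Fintype.sum_prod_type, Matrix.mul_sum, Matrix.sum_mul,
    conjTranspose_mul, Matrix.mul_assoc]

theorem apply_eq_sum_single [DecidableEq A] {Φ : Matrix A A ℂ → Matrix B B ℂ}
    (hΦ : IsLinearMap ℂ Φ) (X : Matrix A A ℂ) (b b' : B) :
    Φ X b b' = ∑ i, ∑ j, X i j * Φ (Matrix.single i j 1) b b' := by
  conv_lhs => rw [Matrix.matrix_eq_sum_single X]
  rw [← IsLinearMap.mk'_apply (lin := hΦ)]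
  simp only [map_sum, Matrix.sum_apply]
  refine Finset.sum_congr rfl fun i _ => Finset.sum_congr rfl fun j _ => ?_
  have : Matrix.single i j (X i j) = X i j • Matrix.single i j (1 : ℂ) := by
    simp [Matrix.smul_single]
  rw [this, map_smul]
  simp

/-- Choi's theorem. -/
theorem exists_krausMap [DecidableEq A] [DecidableEq B] {Φ : Matrix A A ℂ → Matrix B B ℂ}
    (hΦ : IsLinearMap ℂ Φ) (hcp : IsCompletelyPositive Φ) :
    ∃ K : A × B → Matrix B A ℂ, Φ = krausMap K := by
  let ω : A × A → ℂ := fun i => if i.1 = i.2 then 1 else 0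
  have hJ := ampliation_posSemidef hcp (ketbra_posSemidef ω)
  have hblock (a a' : A) : (Matrix.of fun x x' => ketbra ω ω (a, x) (a', x')) =
      Matrix.single a a' 1 := by
    ext x x'
    by_cases h : a = x <;> by_cases h' : a' = x' <;>
      simp [ω, ketbra, vecMulVec_apply, h, h']
  -- The Kraus operators are the columns of the square root of the Choi matrix, reshaped. There are
  -- exactly `A × B` of them, the size prescribed for the environment.
  refine ⟨fun e => Matrix.of fun b a => rpow (ampliation Φ (ketbra ω ω)) (1 / 2) (a, b) e, ?_⟩
  funext X
  ext b b'
  rw [apply_eq_sum_single hΦ, krausMap_apply]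
  symm
  refine Finset.sum_comm.trans (Finset.sum_congr rfl fun a _ =>
    Finset.sum_comm.trans (Finset.sum_congr rfl fun a' _ => ?_))
  have h := congrFun (congrFun (rpow_half_mul_self hJ) (a, b)) (a', b')
  rw [mul_apply] at h
  conv_rhs at h => simp only [ampliation, of_apply, hblock]
  rw [← h, Finset.mul_sum]
  refine Finset.sum_congr rfl fun e _ => ?_
  rw [← (rpow_half_isHermitian _).apply e (a', b')]
  simp only [of_apply]
  ring

theorem sum_conjTranspose_mul_self_eq_one [DecidableEq A] {K : ι → Matrix B A ℂ}
    (h : ∀ X, (krausMap K X).trace = X.trace) : ∑ e, (K e)ᴴ * K e = 1 := by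
  ext i j
  have := h (Matrix.single j i 1)
  rw [trace_krausMap, trace_mul_single] at this
  rw [show (∑ e, (K e)ᴴ * K e) i j = _ by simpa using this]
  by_cases hij : i = j
  · subst hij; simp
  · rw [trace_single_eq_of_ne _ _ _ (Ne.symm hij), one_apply_ne hij]

theorem adjointMap_krausMap [DecidableEq A] (K : ι → Matrix B A ℂ) (Y : Matrix B B ℂ) :
    adjointMap (krausMap K) Y = krausMap (fun e => (K e)ᴴ) Y := by
  ext i j
  simp only [adjointMap, of_apply, krausMap, conjTranspose_sum, conjTranspose_mul,
    conjTranspose_conjTranspose, conjTranspose_single, star_one, Finset.sum_mul, trace_sum,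
    Matrix.sum_apply]
  refine Finset.sum_congr rfl fun e _ => ?_
  rw [Matrix.mul_assoc, trace_mul_comm, Matrix.mul_assoc, Matrix.mul_assoc, Matrix.mul_assoc,
    trace_single_mul]
  simp

end Kraus

/-! ### Partial traces and tensor products -/

section PartialTrace

variable {A B C R E : Type*} [Fintype A] [Fintype B] [Fintype C] [Fintype R] [Fintype E]

theorem trace_trSnd (X : Matrix (A × B) (A × B) ℂ) : (trSnd X).trace = X.trace := by
  simp [Matrix.trace, trSnd, Fintype.sum_prod_type]

theorem trace_trFst (X : Matrix (A × B) (A × B) ℂ) : (trFst X).trace = X.trace := by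
  simp [Matrix.trace, trFst, Fintype.sum_prod_type_right]

theorem trace_trMid (X : Matrix ((R × B) × E) ((R × B) × E) ℂ) : (trMid X).trace = X.trace := by
  simp only [Matrix.trace, trMid, diag_apply, of_apply, Fintype.sum_prod_type]
  exact Finset.sum_congr rfl fun r _ => Finset.sum_comm

theorem trSnd_kronecker (P : Matrix A A ℂ) (Q : Matrix B B ℂ) :
    trSnd (P ⊗ₖ Q) = Q.trace • P := by
  ext i j
  simp [trSnd, Matrix.trace, ← Finset.mul_sum, mul_comm]

theorem trFst_kronecker (P : Matrix A A ℂ) (Q : Matrix B B ℂ) :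
    trFst (P ⊗ₖ Q) = P.trace • Q := by
  ext i j
  simp [trFst, Matrix.trace, ← Finset.sum_mul]

theorem eq_kronecker_marginals {X : Matrix (A × B) (A × B) ℂ} (hX : X.trace = 1)
    {P : Matrix A A ℂ} {Q : Matrix B B ℂ} (h : X = P ⊗ₖ Q) : X = trSnd X ⊗ₖ trFst X := by
  have : P.trace * Q.trace = 1 := by rw [← trace_kronecker, ← h, hX]
  rw [h, trSnd_kronecker, trFst_kronecker, smul_kronecker, kronecker_smul, smul_smul,
    mul_comm, this, one_smul]

theorem trace_kronecker_one_mul [DecidableEq B] (P : Matrix A A ℂ)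
    (X : Matrix (A × B) (A × B) ℂ) :
    ((P ⊗ₖ (1 : Matrix B B ℂ)) * X).trace = (P * trSnd X).trace := by
  simp only [Matrix.trace, diag_apply, mul_apply, Fintype.sum_prod_type, kroneckerMap_apply,
    one_apply, mul_ite, mul_one, mul_zero, ite_mul, zero_mul, trSnd, of_apply,
    Finset.mul_sum, Finset.sum_ite_eq, Finset.mem_univ, if_true]
  exact Finset.sum_congr rfl fun r _ => Finset.sum_comm

theorem trace_ketbra_mul (v : A → ℂ) (X : Matrix A A ℂ) :
    (ketbra v v * X).trace = star v ⬝ᵥ (X *ᵥ v) := by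
  rw [ketbra, vecMulVec_mul, trace_vecMulVec, dotProduct_comm, dotProduct_mulVec]

theorem trace_ketbra (v : A → ℂ) : (ketbra v v).trace = star v ⬝ᵥ v := by
  rw [ketbra, trace_vecMulVec, dotProduct_comm]

/-- A positive operator whose weight lies in the range of a projection is supported there. -/
theorem compress_eq_self [DecidableEq A] {P τ : Matrix A A ℂ} (hP : P.IsHermitian)
    (hPP : P * P = P) (hτ : τ.PosSemidef) (h : (P * τ).trace = τ.trace) : P * τ * P = τ := by
  set S := rpow τ (1 / 2) with hS
  have hSS : S * S = τ := rpow_half_mul_self hτ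
  have hSH : Sᴴ = S := rpow_half_isHermitian τ
  have h0 : ((1 - P) * S) * ((1 - P) * S)ᴴ = (1 - P) * τ * (1 - P) := by
    rw [conjTranspose_mul, conjTranspose_sub, conjTranspose_one, hP.eq, hSH, ← hSS]
    simp only [Matrix.mul_assoc]
  have hQQ : (1 - P) * (1 - P) = 1 - P := by
    rw [Matrix.mul_sub, Matrix.sub_mul, Matrix.sub_mul, hPP]; simp
  -- The squared Hilbert-Schmidt norm of `(1 - P) * S` is the missing weight `tr τ - tr (P τ)`.
  have h1 : (1 - P) * S = 0 := by
    rw [← trace_mul_conjTranspose_self_eq_zero_iff, h0, trace_mul_comm, ← Matrix.mul_assoc, hQQ,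
      Matrix.sub_mul, Matrix.one_mul, trace_sub, h, sub_self]
  have h2 : P * S = S := by
    rw [Matrix.sub_mul, Matrix.one_mul, sub_eq_zero] at h1
    exact h1.symm
  have h3 : S * P = S := by
    have := congrArg conjTranspose h2
    rwa [conjTranspose_mul, hP.eq, hSH] at this
  rw [← hSS, ← Matrix.mul_assoc, h2, Matrix.mul_assoc, h3]

theorem ketbra_kronecker_one_compress [DecidableEq B] (v : A → ℂ)
    (X : Matrix (A × B) (A × B) ℂ) :
    (ketbra v v ⊗ₖ (1 : Matrix B B ℂ)) * X * (ketbra v v ⊗ₖ (1 : Matrix B B ℂ)) =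
      ketbra v v ⊗ₖ Matrix.of fun e e' => ∑ s, ∑ s', star (v s) * X (s, e) (s', e') * v s' := by
  ext ⟨s, e⟩ ⟨s', e'⟩
  simp only [mul_apply, Fintype.sum_prod_type, kroneckerMap_apply, one_apply, mul_ite, mul_one,
    mul_zero, ite_mul, zero_mul, Finset.sum_ite_eq, Finset.sum_ite_eq', Finset.mem_univ, if_true,
    of_apply, ketbra, vecMulVec_apply, Pi.star_apply, Finset.mul_sum, Finset.sum_mul]
  rw [Finset.sum_comm]
  refine Finset.sum_congr rfl fun u _ => Finset.sum_congr rfl fun u' _ => ?_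
  ring

/-- A positive operator with a pure marginal is a product. -/
theorem eq_kronecker_of_pure_marginal [DecidableEq A] [DecidableEq B] {v : A → ℂ}
    (hv : star v ⬝ᵥ v = 1)
    {X : Matrix (A × B) (A × B) ℂ} (hX : X.PosSemidef)
    (h : star v ⬝ᵥ (trSnd X *ᵥ v) = X.trace) : ∃ Q : Matrix B B ℂ, X = ketbra v v ⊗ₖ Q := by
  refine ⟨Matrix.of fun e e' => ∑ s, ∑ s', star (v s) * X (s, e) (s', e') * v s', ?_⟩
  -- The hypothesis `h` puts the whole weight of `X` in the range of `|v⟩⟨v| ⊗ 1`, and compression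
  -- to that range always yields a product.
  rw [← ketbra_kronecker_one_compress, compress_eq_self _ _ hX]
  · rw [trace_kronecker_one_mul, trace_ketbra_mul, h]
  · rw [Matrix.IsHermitian, conjTranspose_kronecker, (ketbra_posSemidef v).1.eq,
      conjTranspose_one]
  · rw [← mul_kronecker_mul, ketbra_mul_self, hv, one_smul, Matrix.one_mul]

end PartialTrace

/-! ### Entanglement fidelity one -/

section Fidelity

variable {A B R E ι : Type*} [Fintype A] [DecidableEq A] [Fintype B] [DecidableEq B]
  [Fintype R] [DecidableEq R] [Fintype E] [DecidableEq E] [Fintype ι]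

theorem isLinearMap_comp {Φ : Matrix A A ℂ → Matrix B B ℂ} {D : Matrix B B ℂ → Matrix A A ℂ}
    (hD : IsLinearMap ℂ D) (hΦ : IsLinearMap ℂ Φ) : IsLinearMap ℂ (D ∘ Φ) :=
  ⟨fun X Y => by simp [hΦ.map_add, hD.map_add], fun c X => by simp [hΦ.map_smul, hD.map_smul]⟩

theorem IsCompletelyPositive.comp {Φ : Matrix A A ℂ → Matrix B B ℂ}
    {D : Matrix B B ℂ → Matrix A A ℂ} (hD : IsCompletelyPositive D)
    (hΦ : IsCompletelyPositive Φ) : IsCompletelyPositive (D ∘ Φ) :=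
  fun n X hX => hD n _ (hΦ n X hX)

theorem IsChannel.comp {Φ : Matrix A A ℂ → Matrix B B ℂ} {D : Matrix B B ℂ → Matrix A A ℂ}
    (hD : IsChannel D) (hΦ : IsChannel Φ) : IsChannel (D ∘ Φ) :=
  ⟨isLinearMap_comp hD.1 hΦ.1, IsCompletelyPositive.comp hD.2 hΦ.2, fun X => by simp [hD.3, hΦ.3]⟩

theorem trace_ampliation {Φ : Matrix A A ℂ → Matrix B B ℂ} (hΦ : IsChannel Φ)
    (X : Matrix (R × A) (R × A) ℂ) : (ampliation Φ X).trace = X.trace := by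
  simp only [Matrix.trace, diag_apply, ampliation, of_apply, Fintype.sum_prod_type]
  refine Finset.sum_congr rfl fun r _ => ?_
  exact hΦ.3 (Matrix.of fun a a' => X (r, a) (r, a'))

theorem entanglementFidelity_eq_one_of_ampliation {ρ : Matrix A A ℂ} (hρ : IsState ρ)
    {M : Matrix A A ℂ → Matrix A A ℂ} (hM : IsLinearMap ℂ M) (hcp : IsCompletelyPositive M)
    {ψ : R × A → ℂ} (hψ : trFst (ketbra ψ ψ) = ρ)
    (h : ampliation M (ketbra ψ ψ) = ketbra ψ ψ) : entanglementFidelity ρ M = 1 := by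
  have h1 := star_dotProduct_of_purifies hρ ψ hψ
  rw [(entanglementFidelity_eq hρ hM hcp ψ hψ).2, h, ← trace_ketbra_mul, ketbra_mul_self, h1,
    one_smul, trace_ketbra, h1, Complex.one_re]

/-- A vector in `R ⊗ A` as an operator from `R` to `A`. -/
def vecToMatrix {R A : Type*} (ψ : R × A → ℂ) : Matrix A R ℂ := Matrix.of fun a r => ψ (r, a)

theorem ampliation_krausMap_ketbra (K : ι → Matrix B A ℂ) (ψ : R × A → ℂ) (i j : R × B) :
    ampliation (krausMap K) (ketbra ψ ψ) i j =
      ∑ e, (K e * vecToMatrix ψ) i.2 i.1 * star ((K e * vecToMatrix ψ) j.2 j.1) := by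
  simp only [ampliation, of_apply, krausMap_apply, ketbra, vecMulVec_apply, Pi.star_apply,
    mul_apply, vecToMatrix, star_sum, star_mul', Finset.sum_mul_sum]
  refine Finset.sum_congr rfl fun e _ => Finset.sum_congr rfl fun a _ =>
    Finset.sum_congr rfl fun a' _ => ?_
  ring

/-- Kraus operators that act on the purification as scalars of total weight one do not disturb it.
Recovery by the Petz and Schumacher-Westmoreland decoders is proved in this form. -/
theorem ampliation_krausMap_of_fixed {K : ι → Matrix A A ℂ} {ψ : R × A → ℂ} {c : ι → ℂ}
    (hK : ∀ e, K e * vecToMatrix ψ = c e • vecToMatrix ψ) (hc : ∑ e, c e * star (c e) = 1) :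
    ampliation (krausMap K) (ketbra ψ ψ) = ketbra ψ ψ := by
  ext i j
  rw [ampliation_krausMap_ketbra]
  simp only [hK]
  simp only [Matrix.smul_apply, vecToMatrix, of_apply, smul_eq_mul, star_mul', ketbra,
    vecMulVec_apply, Pi.star_apply]
  rw [← one_mul (ψ i * star (ψ j)), ← hc, Finset.sum_mul]
  exact Finset.sum_congr rfl fun e _ => by ring

/-- Perfect recovery decouples the reference from the environment. -/
theorem trMid_eq_kronecker_of_recovery {ρ : Matrix A A ℂ} (hρ : IsState ρ)
    {N : Matrix A A ℂ → Matrix B B ℂ} (hN : IsChannel N) {D : Matrix B B ℂ → Matrix A A ℂ}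
    (hD : IsChannel D) (hF : entanglementFidelity ρ (D ∘ N) = 1)
    {ψ : R × A → ℂ} (hψ : trFst (ketbra ψ ψ) = ρ)
    {φ : (R × B) × E → ℂ} (hφ : trSnd (ketbra φ φ) = ampliation N (ketbra ψ ψ)) :
    trMid (ketbra φ φ) = trSnd (trMid (ketbra φ φ)) ⊗ₖ trFst (trMid (ketbra φ φ)) := by
  have hψ1 := star_dotProduct_of_purifies hρ ψ hψ
  have htr : (ketbra φ φ).trace = 1 := by
    rw [← trace_trSnd, hφ, trace_ampliation hN, trace_ketbra, hψ1]
  -- The factors are reordered so that `D` acts on the last one, with `R × E` as its reference; `τ`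
  -- restores the order afterwards.
  let X : Matrix ((R × E) × B) ((R × E) × B) ℂ :=
    (ketbra φ φ).submatrix (fun i => ((i.1.1, i.2), i.1.2)) (fun i => ((i.1.1, i.2), i.1.2))
  have hX : X.PosSemidef := (ketbra_posSemidef φ).submatrix _
  let τ : Matrix ((R × A) × E) ((R × A) × E) ℂ :=
    (ampliation D X).submatrix (fun i => ((i.1.1, i.2), i.1.2)) (fun i => ((i.1.1, i.2), i.1.2))
  have hτ : τ.PosSemidef := (ampliation_posSemidef hD.2 hX).submatrix _
  -- Since `D` preserves the trace, discarding its output amounts to discarding its input.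
  have hmid : trMid τ = trMid (ketbra φ φ) := by
    ext i j
    exact hD.3 (Matrix.of fun b b' => X (i, b) (j, b'))
  have hsnd : trSnd τ = ampliation (D ∘ N) (ketbra ψ ψ) := by
    have : ampliation (D ∘ N) (ketbra ψ ψ) = ampliation D (trSnd (ketbra φ φ)) := by rw [hφ]; rfl
    rw [this]
    ext i j
    have hs : (Matrix.of fun b b' => trSnd (ketbra φ φ) (i.1, b) (j.1, b')) =
        ∑ e, Matrix.of fun b b' => X ((i.1, e), b) ((j.1, e), b') := by
      ext b b'
      simp only [Matrix.sum_apply, of_apply, trSnd]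
      rfl
    simp only [ampliation, of_apply]
    rw [hs, ← IsLinearMap.mk'_apply (lin := hD.1), map_sum, Matrix.sum_apply]
    rfl
  -- Fidelity one means that the `RA` marginal has all its weight on `ψ`.
  have hpure : star ψ ⬝ᵥ (trSnd τ *ᵥ ψ) = τ.trace := by
    rw [← trace_trMid, hmid, trace_trMid, htr, hsnd]
    have h1 := (entanglementFidelity_eq hρ (hD.comp hN).1 (hD.comp hN).2 ψ hψ).2
    rw [hF] at h1
    have h2 := (ampliation_posSemidef (R := R) (hD.comp hN).2
      (ketbra_posSemidef ψ)).dotProduct_mulVec_nonneg ψ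
    exact Complex.ext h1.symm (by simpa using (Complex.nonneg_iff.1 h2).2.symm)
  obtain ⟨Q, hQ⟩ := eq_kronecker_of_pure_marginal hψ1 hτ hpure
  refine eq_kronecker_marginals (P := trSnd (ketbra ψ ψ)) (Q := Q) (by rw [trace_trMid, htr]) ?_
  rw [← hmid, hQ]
  ext i j
  simp [trMid, trSnd, Finset.sum_mul]

end Fidelity

/-! ### Entropy -/

section Entropy

variable {A B R E : Type*} [Fintype A] [DecidableEq A] [Fintype B] [DecidableEq B]
  [Fintype R] [DecidableEq R] [Fintype E] [DecidableEq E]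

theorem entropy_conjDiag {U : Matrix A A ℂ} (hU : U ∈ unitaryGroup A ℂ) (d : A → ℝ) :
    entropy (conjDiag U fun i => (d i : ℂ)) = -(∑ i, d i * Real.log (d i)) / Real.log 2 := by
  rw [entropy, cfc_conjDiag hU, conjDiag_mul_conjDiag hU, trace_conjDiag hU]
  simp only [Real.logb, ← Complex.ofReal_mul, ← Complex.ofReal_sum, Complex.ofReal_re,
    Finset.sum_div, mul_div_assoc, neg_div]

/-- `M` carries the logarithm of `Mᴴ * M` to that of `M * Mᴴ`; cyclicity of the trace does the rest,
with no comparison of spectra. -/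
theorem entropy_mul_conjTranspose (M : Matrix A B ℂ) : entropy (M * Mᴴ) = entropy (Mᴴ * M) := by
  have h := cfc_mul_of_intertwine (posSemidef_self_mul_conjTranspose M).1
    (posSemidef_conjTranspose_mul_self M).1 (Matrix.mul_assoc M Mᴴ M) (Real.logb 2)
  rw [entropy, entropy, Matrix.mul_assoc, trace_mul_comm, Matrix.mul_assoc, h, ← Matrix.mul_assoc]

theorem entropy_transpose {X : Matrix A A ℂ} (hX : X.IsHermitian) : entropy Xᵀ = entropy X := by
  rw [entropy, entropy, cfc_transpose hX, ← transpose_mul, trace_transpose, trace_mul_comm]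

theorem trFst_ketbra (φ : A × B → ℂ) :
    trFst (ketbra φ φ) = vecToMatrix φ * (vecToMatrix φ)ᴴ := by
  ext i j
  simp [trFst, ketbra, vecToMatrix, vecMulVec_apply, mul_apply]

theorem trSnd_ketbra (φ : A × B → ℂ) :
    trSnd (ketbra φ φ) = ((vecToMatrix φ)ᴴ * vecToMatrix φ)ᵀ := by
  ext i j
  simp [trSnd, ketbra, vecToMatrix, vecMulVec_apply, mul_apply, mul_comm]

theorem entropy_trFst_ketbra (φ : A × B → ℂ) :
    entropy (trFst (ketbra φ φ)) = entropy (trSnd (ketbra φ φ)) := by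
  rw [trFst_ketbra, trSnd_ketbra, entropy_transpose (posSemidef_conjTranspose_mul_self _).1,
    entropy_mul_conjTranspose]

/-- With a trivial second factor adjoined, the complementary marginal is the number `1`, and
complementary marginals have equal entropy. -/
theorem entropy_ketbra {ψ : A → ℂ} (hψ : star ψ ⬝ᵥ ψ = 1) : entropy (ketbra ψ ψ) = 0 := by
  have h1 : ketbra ψ ψ = trSnd (ketbra (fun i : A × Unit => ψ i.1) fun i => ψ i.1) := by
    ext i j
    simp [trSnd, ketbra, vecMulVec_apply]
  have h2 : trFst (ketbra (fun i : A × Unit => ψ i.1) fun i => ψ i.1) = 1 := by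
    ext i j
    rw [show (1 : Matrix Unit Unit ℂ) i j = 1 by simp [one_apply], ← hψ]
    simp [trFst, ketbra, vecMulVec_apply, dotProduct, mul_comm]
  have h3 : cfc (Real.logb 2) (1 : Matrix Unit Unit ℂ) = 0 := by simp
  rw [h1, ← entropy_trFst_ketbra, h2, entropy, h3]
  simp

/-- The equality case of Klein's inequality, for a diagonal second argument. -/
theorem eq_diagonal_of_klein_eq {U : Matrix A A ℂ} (hU : U ∈ unitaryGroup A ℂ) {x y : A → ℝ}
    (hx : ∀ i, 0 ≤ x i) (hy : ∀ i, 0 ≤ y i) (hsum : ∑ i, x i = ∑ i, y i)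
    (h0 : ∀ j, y j = 0 → (conjDiag U fun i => (x i : ℂ)) j j = 0)
    (heq : ∑ i, x i * Real.log (x i) =
      ∑ j, ((conjDiag U fun i => (x i : ℂ)) j j).re * Real.log (y j)) :
    (conjDiag U fun i => (x i : ℂ)) = diagonal fun i => (y i : ℂ) := by
  -- These overlaps form a doubly stochastic matrix, which reduces the problem to scalars.
  let w : A → A → ℝ := fun j i => ‖U j i‖ ^ 2
  have hw (j i : A) : (w j i : ℂ) = U j i * star (U j i) := by
    simp only [w]; push_cast; exact (Complex.mul_conj' _).symm
  have hw0 (j i : A) : 0 ≤ w j i := by positivity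
  have hrow (j : A) : ∑ i, w j i = 1 := by
    have := congrFun (congrFun (unitary_mul_conjTranspose hU) j) j
    simp only [mul_apply, conjTranspose_apply, ← hw, one_apply_eq] at this
    exact_mod_cast this
  have hcol (i : A) : ∑ j, w j i = 1 := by
    have := congrFun (congrFun (unitary_conjTranspose_mul hU) i) i
    simp only [mul_apply, conjTranspose_apply, mul_comm (star _), ← hw, one_apply_eq] at this
    exact_mod_cast this
  have hdiag (j : A) : (conjDiag U fun i => (x i : ℂ)) j j = ((∑ i, w j i * x i : ℝ) : ℂ) := by
    push_cast
    rw [conjDiag, mul_apply]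
    refine Finset.sum_congr rfl fun i _ => ?_
    rw [mul_diagonal, conjTranspose_apply, hw]
    ring
  have hzero (j i : A) (hj : y j = 0) : w j i * x i = 0 := by
    have h1 := h0 j hj
    rw [hdiag] at h1
    have h2 : ∑ i, w j i * x i = 0 := by exact_mod_cast h1
    exact (Finset.sum_eq_zero_iff_of_nonneg fun i _ => mul_nonneg (hw0 j i) (hx i)).1 h2 i
      (Finset.mem_univ _)
  -- The terms of Klein's inequality: each is nonnegative, and their sum vanishes by `heq`, the part
  -- `-x i + y j` cancelling by `hsum`.
  let t : A → A → ℝ := fun j i =>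
    w j i * (x i * Real.log (x i) - x i * Real.log (y j) - x i + y j)
  have hpos (a b : ℝ) (ha : 0 ≤ a) (hb : 0 < b) (hab : a ≠ b) :
      0 < a * Real.log a - a * Real.log b - a + b := by
    rcases ha.eq_or_lt with h | h
    · simp [← h, hb]
    · have h1 := Real.log_lt_sub_one_of_pos (div_pos hb h) (by
        rw [ne_eq, div_eq_one_iff_eq h.ne']; exact hab.symm)
      rw [Real.log_div hb.ne' h.ne'] at h1
      have h2 := mul_lt_mul_of_pos_left h1 h
      have h3 : a * (b / a - 1) = b - a := by field_simp
      rw [h3] at h2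
      linarith
  have ht0 (j i : A) : 0 ≤ t j i := by
    -- Because `Real.log 0 = 0`, nonnegativity at `y j = 0` has to come from the support condition
    -- `h0`, through `hzero`.
    by_cases hj : y j = 0
    · rcases mul_eq_zero.1 (hzero j i hj) with h | h <;> simp [t, h, hj]
    · by_cases hij : x i = y j
      · simp [t, hij]
      · exact mul_nonneg (hw0 j i) (hpos _ _ (hx i) ((hy j).lt_of_ne' hj) hij).le
  have htsum : ∑ j, ∑ i, t j i = 0 := by
    have e1 : ∑ j, ∑ i, w j i * (x i * Real.log (x i)) = ∑ i, x i * Real.log (x i) := by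
      rw [Finset.sum_comm]
      exact Finset.sum_congr rfl fun i _ => by rw [← Finset.sum_mul, hcol, one_mul]
    have e2 : ∑ j, ∑ i, w j i * (x i * Real.log (y j)) = ∑ i, x i * Real.log (x i) := by
      rw [heq]
      refine Finset.sum_congr rfl fun j _ => ?_
      rw [hdiag, Complex.ofReal_re, Finset.sum_mul]
      exact Finset.sum_congr rfl fun i _ => by ring
    have e3 : ∑ j, ∑ i, w j i * x i = ∑ i, x i := by
      rw [Finset.sum_comm]
      exact Finset.sum_congr rfl fun i _ => by rw [← Finset.sum_mul, hcol, one_mul]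
    have e4 : ∑ j, ∑ i, w j i * y j = ∑ i, y i :=
      Finset.sum_congr rfl fun j _ => by rw [← Finset.sum_mul, hrow, one_mul]
    simp only [t, mul_add, mul_sub, Finset.sum_add_distrib, Finset.sum_sub_distrib, e1, e2, e3, e4,
      hsum]
    ring
  -- Strictness of the scalar inequality gives `x i = y j` wherever `U j i ≠ 0`, so `U` intertwines
  -- the two diagonal matrices.
  have hwxy (j i : A) : U j i * (x i : ℂ) = (y j : ℂ) * U j i := by
    have h1 := (Finset.sum_eq_zero_iff_of_nonneg fun j _ => Finset.sum_nonneg fun i _ => ht0 j i).1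
      htsum j (Finset.mem_univ _)
    have h2 := (Finset.sum_eq_zero_iff_of_nonneg fun i _ => ht0 j i).1 h1 i (Finset.mem_univ _)
    rcases mul_eq_zero.1 h2 with h | h
    · have : U j i = 0 := by simpa [w] using h
      simp [this]
    · by_cases hU0 : U j i = 0
      · simp [hU0]
      have hij : x i = y j := by
        by_contra hij
        by_cases hj : y j = 0
        · rcases mul_eq_zero.1 (hzero j i hj) with h' | h'
          · exact hU0 (by simpa [w] using h')
          · exact hij (h'.trans hj.symm)
        · exact (hpos _ _ (hx i) ((hy j).lt_of_ne' hj) hij).ne' h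
      rw [hij, mul_comm]
  have hUd : U * diagonal (fun i => (x i : ℂ)) = diagonal (fun i => (y i : ℂ)) * U := by
    ext j i
    rw [mul_diagonal, diagonal_mul, hwxy]
  rw [conjDiag, hUd, Matrix.mul_assoc, unitary_mul_conjTranspose hU, Matrix.mul_one]

theorem trace_one_kronecker_mul (P : Matrix B B ℂ) (X : Matrix (A × B) (A × B) ℂ) :
    (((1 : Matrix A A ℂ) ⊗ₖ P) * X).trace = (P * trFst X).trace := by
  simp only [Matrix.trace, diag_apply, mul_apply, Fintype.sum_prod_type, kroneckerMap_apply,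
    one_apply, ite_mul, one_mul, zero_mul, trFst, of_apply, Finset.mul_sum]
  rw [Finset.sum_comm]
  refine Finset.sum_congr rfl fun b _ => ?_
  rw [Finset.sum_comm (s := (Finset.univ : Finset B))]
  refine Finset.sum_congr rfl fun a _ => ?_
  rw [Finset.sum_comm]
  simp

/-- The partial trace is dual to `Z ↦ Z ⊗ₖ 1`; after pairing with `Z`, the unitary `V` cancels
against its adjoint. -/
theorem trSnd_kronecker_conj {U : Matrix A A ℂ} {V : Matrix B B ℂ} (hV : V ∈ unitaryGroup B ℂ)
    (X : Matrix (A × B) (A × B) ℂ) :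
    trSnd ((U ⊗ₖ V)ᴴ * X * (U ⊗ₖ V)) = Uᴴ * trSnd X * U := by
  refine Matrix.ext_iff_trace_mul_left.2 fun Z => ?_
  rw [← trace_kronecker_one_mul, ← Matrix.mul_assoc, trace_mul_comm, ← Matrix.mul_assoc,
    ← Matrix.mul_assoc, conjTranspose_kronecker, ← mul_kronecker_mul, ← mul_kronecker_mul,
    Matrix.mul_one, unitary_mul_conjTranspose hV, trace_kronecker_one_mul, ← Matrix.mul_assoc,
    trace_mul_comm _ U]
  simp only [Matrix.mul_assoc]

theorem trFst_kronecker_conj {U : Matrix A A ℂ} {V : Matrix B B ℂ} (hU : U ∈ unitaryGroup A ℂ)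
    (X : Matrix (A × B) (A × B) ℂ) :
    trFst ((U ⊗ₖ V)ᴴ * X * (U ⊗ₖ V)) = Vᴴ * trFst X * V := by
  refine Matrix.ext_iff_trace_mul_left.2 fun Z => ?_
  rw [← trace_one_kronecker_mul, ← Matrix.mul_assoc, trace_mul_comm, ← Matrix.mul_assoc,
    ← Matrix.mul_assoc, conjTranspose_kronecker, ← mul_kronecker_mul, ← mul_kronecker_mul,
    Matrix.mul_one, unitary_mul_conjTranspose hU, trace_one_kronecker_mul, ← Matrix.mul_assoc,
    trace_mul_comm _ V]
  simp only [Matrix.mul_assoc]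

theorem entropy_kronecker {P : Matrix A A ℂ} {Q : Matrix B B ℂ} (hP : IsState P)
    (hQ : IsState Q) : entropy (P ⊗ₖ Q) = entropy P + entropy Q := by
  obtain ⟨hP, hP1⟩ := hP
  obtain ⟨hQ, hQ1⟩ := hQ
  obtain ⟨U, hU, p, hp, rfl⟩ := exists_conjDiag_nonneg hP
  obtain ⟨V, hV, q, hq, rfl⟩ := exists_conjDiag_nonneg hQ
  rw [trace_conjDiag hU] at hP1
  rw [trace_conjDiag hV] at hQ1
  have hp1 : ∑ i, p i = 1 := by exact_mod_cast hP1
  have hq1 : ∑ i, q i = 1 := by exact_mod_cast hQ1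
  rw [conjDiag_kronecker]
  simp only [← Complex.ofReal_mul]
  rw [entropy_conjDiag (kronecker_mem_unitaryGroup hU hV) fun i => p i.1 * q i.2,
    entropy_conjDiag hU, entropy_conjDiag hV, ← add_div, ← neg_add]
  congr 2
  have hterm (a : A) (b : B) : p a * q b * Real.log (p a * q b) =
      p a * Real.log (p a) * q b + p a * (q b * Real.log (q b)) := by
    by_cases ha : p a = 0
    · simp [ha]
    by_cases hb : q b = 0
    · simp [hb]
    rw [Real.log_mul ha hb]
    ring
  simp only [Fintype.sum_prod_type, hterm, Finset.sum_add_distrib, ← Finset.mul_sum, hq1, mul_one,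
    ← Finset.sum_mul, hp1, one_mul]

theorem trSnd_posSemidef {X : Matrix (A × B) (A × B) ℂ} (hX : X.PosSemidef) :
    (trSnd X).PosSemidef := by
  have : trSnd X = ∑ b, X.submatrix (fun a => (a, b)) (fun a => (a, b)) := by
    ext i j
    simp [trSnd, Matrix.sum_apply]
  rw [this]
  exact posSemidef_sum _ fun b _ => hX.submatrix _

theorem trFst_posSemidef {X : Matrix (A × B) (A × B) ℂ} (hX : X.PosSemidef) :
    (trFst X).PosSemidef := by
  have : trFst X = ∑ a, X.submatrix (fun b => (a, b)) (fun b => (a, b)) := by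
    ext i j
    simp [trFst, Matrix.sum_apply]
  rw [this]
  exact posSemidef_sum _ fun b _ => hX.submatrix _

/-- The equality case of the subadditivity of the entropy. -/
theorem eq_kronecker_of_entropy_eq {X : Matrix (A × B) (A × B) ℂ} (hX : IsState X)
    (h : entropy X = entropy (trSnd X) + entropy (trFst X)) : X = trSnd X ⊗ₖ trFst X := by
  obtain ⟨hX, hX1⟩ := hX
  obtain ⟨U, hU, p, hp, hP⟩ := exists_conjDiag_nonneg (trSnd_posSemidef hX)
  obtain ⟨V, hV, q, hq, hQ⟩ := exists_conjDiag_nonneg (trFst_posSemidef hX)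
  obtain ⟨Z, hZ, x, hx, hXd⟩ := exists_conjDiag_nonneg hX
  have hW := kronecker_mem_unitaryGroup hU hV
  set W := U ⊗ₖ V with hWdef
  have hT : Wᴴ * Z ∈ unitaryGroup (A × B) ℂ := mul_mem (conjTranspose_mem_unitaryGroup hW) hZ
  have hX' : Wᴴ * X * W = conjDiag (Wᴴ * Z) fun i => (x i : ℂ) := by
    conv_lhs => rw [hXd]
    simp only [conjDiag, conjTranspose_mul, conjTranspose_conjTranspose, Matrix.mul_assoc]
  -- In the eigenbases of the marginals their product is diagonal, as `eq_diagonal_of_klein_eq`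
  -- requires. Its support condition holds because a diagonal entry of `X'` is dominated by the
  -- corresponding entry of each marginal.
  set X' := Wᴴ * X * W with hX'def
  have hX'pos : X'.PosSemidef := hX.conjTranspose_mul_mul_same W
  have hsnd : trSnd X' = diagonal fun i => (p i : ℂ) := by
    rw [hX'def, hWdef, trSnd_kronecker_conj hV, hP, diag_eq_of_conjDiag hU]
  have hfst : trFst X' = diagonal fun i => (q i : ℂ) := by
    rw [hX'def, hWdef, trFst_kronecker_conj hU, hQ, diag_eq_of_conjDiag hV]
  let c : A → B → ℝ := fun a b => (X' (a, b) (a, b)).re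
  have hc (a : A) (b : B) : X' (a, b) (a, b) = (c a b : ℂ) :=
    Complex.ext rfl (by simpa using (Complex.nonneg_iff.1 (hX'pos.diag_nonneg (i := (a, b)))).2.symm)
  have hc0 (a : A) (b : B) : 0 ≤ c a b :=
    (Complex.nonneg_iff.1 (hX'pos.diag_nonneg (i := (a, b)))).1
  have hcp (a : A) : ∑ b, c a b = p a := by
    have := congrFun (congrFun hsnd a) a
    simp only [trSnd, of_apply, hc, diagonal_apply_eq] at this
    exact_mod_cast this
  have hcq (b : B) : ∑ a, c a b = q b := by
    have := congrFun (congrFun hfst b) b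
    simp only [trFst, of_apply, hc, diagonal_apply_eq] at this
    exact_mod_cast this
  have hcp0 (a : A) (b : B) (ha : p a = 0) : c a b = 0 :=
    (Finset.sum_eq_zero_iff_of_nonneg fun b _ => hc0 a b).1 ((hcp a).trans ha) b (Finset.mem_univ _)
  have hcq0 (a : A) (b : B) (hb : q b = 0) : c a b = 0 :=
    (Finset.sum_eq_zero_iff_of_nonneg fun a _ => hc0 a b).1 ((hcq b).trans hb) a (Finset.mem_univ _)
  have hxs : ∑ i, x i = 1 := by
    rw [hXd, trace_conjDiag hZ] at hX1
    exact_mod_cast hX1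
  have hps : ∑ i, p i = 1 := by
    rw [← trace_trSnd, hP, trace_conjDiag hU] at hX1
    exact_mod_cast hX1
  have hqs : ∑ i, q i = 1 := by
    rw [← trace_trFst, hQ, trace_conjDiag hV] at hX1
    exact_mod_cast hX1
  have hlog : ∑ i, x i * Real.log (x i) =
      ∑ a, p a * Real.log (p a) + ∑ b, q b * Real.log (q b) := by
    rw [hP, hQ, entropy_conjDiag hU, entropy_conjDiag hV, ← add_div, ← neg_add] at h
    conv_lhs at h => rw [hXd, entropy_conjDiag hZ]
    have h2 : Real.log 2 ≠ 0 := (Real.log_pos one_lt_two).ne'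
    exact neg_injective ((div_left_inj' h2).1 h)
  have hdiag := eq_diagonal_of_klein_eq hT (x := x) (y := fun i => p i.1 * q i.2) hx
    (fun i => mul_nonneg (hp _) (hq _))
    (by simp only [hxs, Fintype.sum_prod_type, ← Finset.mul_sum, hqs, mul_one, hps])
    (by
      rintro ⟨a, b⟩ h0
      rw [← hX', hc]
      rcases mul_eq_zero.1 h0 with h | h
      · simp [hcp0 a b h]
      · simp [hcq0 a b h])
    (by
      rw [hlog, ← hX', Fintype.sum_prod_type]
      have hterm (a : A) (b : B) : (X' (a, b) (a, b)).re * Real.log (p a * q b) =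
          c a b * Real.log (p a) + c a b * Real.log (q b) := by
        change c a b * _ = _
        by_cases ha : p a = 0
        · simp [hcp0 a b ha]
        by_cases hb : q b = 0
        · simp [hcq0 a b hb]
        rw [Real.log_mul ha hb, mul_add]
      simp only [hterm, Finset.sum_add_distrib, ← Finset.sum_mul, hcp]
      congr 1
      rw [Finset.sum_comm]
      simp only [← Finset.sum_mul, hcq])
  rw [← hX'] at hdiag
  have hback : X = W * X' * Wᴴ := by
    rw [hX'def, ← Matrix.mul_assoc, ← Matrix.mul_assoc, unitary_mul_conjTranspose hW,
      Matrix.one_mul, Matrix.mul_assoc, unitary_mul_conjTranspose hW, Matrix.mul_one]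
  rw [hP, hQ, conjDiag_kronecker, conjDiag, ← hWdef]
  conv_lhs => rw [hback, hdiag]
  simp only [Complex.ofReal_mul]

/-! ### Marginals of a pure tripartite vector. -/

theorem trSnd_trMid (X : Matrix ((R × B) × E) ((R × B) × E) ℂ) :
    trSnd (trMid X) = trSnd (trSnd X) := by
  ext i j
  simp only [trSnd, trMid, of_apply]
  exact Finset.sum_comm

theorem trFst_trMid (X : Matrix ((R × B) × E) ((R × B) × E) ℂ) :
    trFst (trMid X) = trFst X := by
  ext i j
  simp [trFst, trMid, Fintype.sum_prod_type]

theorem trMid_posSemidef {X : Matrix ((R × B) × E) ((R × B) × E) ℂ} (hX : X.PosSemidef) :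
    (trMid X).PosSemidef :=
  trSnd_posSemidef (X := X.submatrix (fun i : (R × E) × B => ((i.1.1, i.2), i.1.2))
    fun i => ((i.1.1, i.2), i.1.2)) (hX.submatrix _)

/-- After regrouping as `(R × E) × B`, the two sides are complementary marginals of one vector. -/
theorem entropy_trMid_ketbra (φ : (R × B) × E → ℂ) :
    entropy (trMid (ketbra φ φ)) = entropy (trFst (trSnd (ketbra φ φ))) := by
  have h1 : trMid (ketbra φ φ) = trSnd (ketbra (fun i : (R × E) × B => φ ((i.1.1, i.2), i.1.2))
      fun i => φ ((i.1.1, i.2), i.1.2)) := rfl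
  have h2 : trFst (trSnd (ketbra φ φ)) =
      trFst (ketbra (fun i : (R × E) × B => φ ((i.1.1, i.2), i.1.2))
        fun i => φ ((i.1.1, i.2), i.1.2)) := by
    ext i j
    simp [trFst, trSnd, Fintype.sum_prod_type, ketbra, vecMulVec_apply]
  rw [h1, h2, entropy_trFst_ketbra]

theorem trSnd_ampliation {N : Matrix A A ℂ → Matrix B B ℂ} (hN : IsChannel N)
    (X : Matrix (R × A) (R × A) ℂ) : trSnd (ampliation N X) = trSnd X := by
  ext i j
  exact hN.3 (Matrix.of fun a a' => X (i, a) (j, a'))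

theorem trFst_ampliation {N : Matrix A A ℂ → Matrix B B ℂ} (hN : IsLinearMap ℂ N)
    (X : Matrix (R × A) (R × A) ℂ) : trFst (ampliation N X) = N (trFst X) := by
  have : trFst X = ∑ r, Matrix.of fun a a' => X (r, a) (r, a') := by
    ext i j
    simp [trFst, Matrix.sum_apply]
  ext i j
  rw [this, ← IsLinearMap.mk'_apply (lin := hN), map_sum, Matrix.sum_apply]
  rfl

/-- The entropic recovery condition is the vanishing of the mutual information of the reference
and the environment. -/
theorem condEntropy_eq_iff {ρ : Matrix A A ℂ} (hρ : IsState ρ)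
    {N : Matrix A A ℂ → Matrix B B ℂ} (hN : IsChannel N)
    {ψ : R × A → ℂ} (hψ : trFst (ketbra ψ ψ) = ρ)
    {φ : (R × B) × E → ℂ} (hφ : trSnd (ketbra φ φ) = ampliation N (ketbra ψ ψ)) :
    condEntropy (ampliation N (ketbra ψ ψ)) = condEntropy (ketbra ψ ψ) ↔
      trMid (ketbra φ φ) = trSnd (trMid (ketbra φ φ)) ⊗ₖ trFst (trMid (ketbra φ φ)) := by
  have hψ1 := star_dotProduct_of_purifies hρ ψ hψ
  have hstate : IsState (trMid (ketbra φ φ)) := ⟨trMid_posSemidef (ketbra_posSemidef φ), by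
    rw [trace_trMid, ← trace_trSnd, hφ, trace_ampliation hN, trace_ketbra, hψ1]⟩
  have hR : entropy (trFst (ketbra ψ ψ)) = entropy (trSnd (trMid (ketbra φ φ))) := by
    rw [trSnd_trMid, hφ, trSnd_ampliation hN, entropy_trFst_ketbra]
  have hE : entropy (trSnd (ketbra φ φ)) = entropy (trFst (trMid (ketbra φ φ))) := by
    rw [trFst_trMid, entropy_trFst_ketbra]
  -- Now `H(RB) = H(E)`, `H(B) = H(RE)`, `H(RA) = 0` and `H(A) = H(R)`, so the condition reads `H(E)
  -- - H(RE) = 0 - H(R)`.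
  rw [condEntropy, condEntropy, entropy_ketbra hψ1, hR, ← hφ, hE, ← entropy_trMid_ketbra]
  constructor
  · intro h
    exact eq_kronecker_of_entropy_eq hstate (by linarith)
  · intro h
    have := entropy_kronecker (P := trSnd (trMid (ketbra φ φ))) (Q := trFst (trMid (ketbra φ φ)))
      ⟨trSnd_posSemidef hstate.1, by rw [trace_trSnd, hstate.2]⟩
      ⟨trFst_posSemidef hstate.1, by rw [trace_trFst, hstate.2]⟩
    rw [← h] at this
    linarith

/-- The purification of `(id ⊗ N)(|ψ⟩⟨ψ|)` given by Kraus operators of `N`. -/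
def krausVec {ι : Type*} (K : ι → Matrix B A ℂ) (ψ : R × A → ℂ) : (R × B) × ι → ℂ :=
  fun i => (K i.2 * vecToMatrix ψ) i.1.2 i.1.1

theorem trSnd_krausVec (K : E → Matrix B A ℂ) (ψ : R × A → ℂ) :
    trSnd (ketbra (krausVec K ψ) (krausVec K ψ)) = ampliation (krausMap K) (ketbra ψ ψ) := by
  ext i j
  rw [ampliation_krausMap_ketbra]
  rfl

/-- The environment sees `ψ` only through its marginal on `A`. -/
theorem trFst_krausVec (K : E → Matrix B A ℂ) (ψ : R × A → ℂ) (e e' : E) :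
    trFst (ketbra (krausVec K ψ) (krausVec K ψ)) e e' =
      (K e * trFst (ketbra ψ ψ) * (K e')ᴴ).trace := by
  rw [trFst_ketbra ψ, Matrix.mul_assoc, Matrix.mul_assoc, ← conjTranspose_mul, ← Matrix.mul_assoc]
  simp only [trFst, Matrix.trace, diag_apply, mul_apply (M := K e * vecToMatrix ψ),
    Fintype.sum_prod_type, conjTranspose_apply, of_apply]
  exact Finset.sum_comm

/-- `H(RB)` is the entropy of the environment and `H(B)` that of `N(ρ)`; both depend on `ρ` alone.
Thus the Petz computation may use the canonical purification although the theorem allows any. -/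
theorem condEntropy_eq_iff_of_purifications {R' : Type*} [Fintype R'] [DecidableEq R']
    {ρ : Matrix A A ℂ} (hρ : IsState ρ)
    {N : Matrix A A ℂ → Matrix B B ℂ} (hN : IsChannel N)
    {ψ : R × A → ℂ} (hψ : trFst (ketbra ψ ψ) = ρ)
    {ψ' : R' × A → ℂ} (hψ' : trFst (ketbra ψ' ψ') = ρ) :
    condEntropy (ampliation N (ketbra ψ ψ)) = condEntropy (ketbra ψ ψ) ↔
      condEntropy (ampliation N (ketbra ψ' ψ')) = condEntropy (ketbra ψ' ψ') := by
  obtain ⟨K, rfl⟩ := exists_krausMap hN.1 hN.2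
  have h : trFst (ketbra (krausVec K ψ) (krausVec K ψ)) =
      trFst (ketbra (krausVec K ψ') (krausVec K ψ')) := by
    ext e e'
    rw [trFst_krausVec, trFst_krausVec, hψ, hψ']
  simp only [condEntropy, ← trSnd_krausVec, ← entropy_trFst_ketbra]
  rw [h, trSnd_krausVec, trSnd_krausVec, trFst_ampliation hN.1, trFst_ampliation hN.1, hψ, hψ',
    entropy_ketbra (star_dotProduct_of_purifies hρ ψ hψ),
    entropy_ketbra (star_dotProduct_of_purifies hρ ψ' hψ')]

end Entropy

/-! ### Completion of trace-nonincreasing decoders -/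

section Completion

variable {A B R E : Type*} [Fintype A] [DecidableEq A] [Fintype B] [DecidableEq B]
  [Fintype R] [DecidableEq R] [Fintype E] [DecidableEq E]

/-- Kraus operators of the map `X ↦ tr (P X) ρ`, for a projection `P`. -/
def replaceKraus (ρ : Matrix A A ℂ) (P : Matrix B B ℂ) (i : A × B) : Matrix A B ℂ :=
  rpow ρ (1 / 2) * Matrix.single i.1 i.2 (1 : ℂ) * P

theorem sum_replaceKraus {ρ : Matrix A A ℂ} (hρ : IsState ρ) {P : Matrix B B ℂ}
    (hP : P.IsHermitian) (hPP : P * P = P) :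
    ∑ i, (replaceKraus ρ P i)ᴴ * replaceKraus ρ P i = P := by
  have h (i : A × B) : (replaceKraus ρ P i)ᴴ * replaceKraus ρ P i =
      P * Matrix.single i.2 i.2 (ρ i.1 i.1) * P := by
    rw [replaceKraus, conjTranspose_mul, conjTranspose_mul, hP.eq, (rpow_half_isHermitian ρ).eq,
      conjTranspose_single, star_one]
    have : Matrix.single i.2 i.1 (1 : ℂ) * rpow ρ (1 / 2) * (rpow ρ (1 / 2) * Matrix.single i.1 i.2 (1 : ℂ)) =
        Matrix.single i.2 i.2 (ρ i.1 i.1) := by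
      rw [Matrix.mul_assoc, ← Matrix.mul_assoc (rpow ρ (1 / 2)), rpow_half_mul_self hρ.1,
        ← Matrix.mul_assoc, single_mul_mul_single]
      simp
    rw [← this]
    simp only [Matrix.mul_assoc]
  have h1 : ∑ i : A × B, Matrix.single i.2 i.2 (ρ i.1 i.1) = 1 := by
    ext b b'
    simp only [Fintype.sum_prod_type, Matrix.sum_apply, Matrix.single_apply]
    by_cases hb : b = b'
    · subst hb
      simpa [Matrix.trace] using hρ.2
    · rw [one_apply_ne hb]
      refine Finset.sum_eq_zero fun a _ => Finset.sum_eq_zero fun x _ => if_neg ?_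
      rintro ⟨rfl, rfl⟩
      exact hb rfl
  simp only [h, ← Matrix.mul_sum, ← Matrix.sum_mul, h1, Matrix.mul_one, hPP]

/-- The difference is the trace of the compression of `τ` to the orthogonal complement of `v`. -/
theorem dotProduct_mulVec_le_trace {v : A → ℂ} (hv : star v ⬝ᵥ v = 1) {τ : Matrix A A ℂ}
    (hτ : τ.PosSemidef) : (star v ⬝ᵥ (τ *ᵥ v)).re ≤ τ.trace.re := by
  have hH : (1 - ketbra v v)ᴴ = 1 - ketbra v v := by
    rw [conjTranspose_sub, conjTranspose_one, (ketbra_posSemidef v).1.eq]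
  have hQQ : (1 - ketbra v v) * (1 - ketbra v v) = 1 - ketbra v v := by
    rw [Matrix.mul_sub, Matrix.sub_mul, Matrix.sub_mul, ketbra_mul_self, hv]; simp
  have h := (hτ.mul_mul_conjTranspose_same (1 - ketbra v v)).trace_nonneg
  rw [hH, trace_mul_comm, ← Matrix.mul_assoc, hQQ, Matrix.sub_mul, Matrix.one_mul, trace_sub,
    trace_ketbra_mul] at h
  have := (Complex.nonneg_iff.1 h).1
  rw [Complex.sub_re] at this
  linarith

/-- A completely positive map that preserves the trace on the range of a projection and achieves
perfect recovery can be completed to a channel that achieves perfect recovery. -/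
theorem exists_channel_of_recovery {ρ : Matrix A A ℂ} (hρ : IsState ρ)
    {N : Matrix A A ℂ → Matrix B B ℂ} (hN : IsChannel N) {D : Matrix B B ℂ → Matrix A A ℂ}
    (hD : IsLinearMap ℂ D) (hcp : IsCompletelyPositive D) {P : Matrix B B ℂ}
    (hP : P.IsHermitian) (hPP : P * P = P) (htr : ∀ X, (D X).trace = (P * X).trace)
    (hF : entanglementFidelity ρ (D ∘ N) = 1) :
    ∃ D' : Matrix B B ℂ → Matrix A A ℂ, IsChannel D' ∧ entanglementFidelity ρ (D' ∘ N) = 1 := by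
  -- The weight outside `P` is sent to the fixed state `ρ`, which restores trace preservation.
  let c := krausMap (replaceKraus ρ (1 - P))
  have hc1 : IsLinearMap ℂ c := krausMap_isLinearMap _
  have hc2 : IsCompletelyPositive c := krausMap_isCompletelyPositive _
  have hch : IsChannel fun X => D X + c X := by
    refine ⟨⟨fun X Y => ?_, fun a X => ?_⟩, fun n X hX => ?_, fun X => ?_⟩
    · rw [hD.map_add, hc1.map_add]; abel
    · rw [hD.map_smul, hc1.map_smul, smul_add]
    · exact (hcp n X hX).add (hc2 n X hX)
    · have hH : (1 - P).IsHermitian := by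
        rw [Matrix.IsHermitian, conjTranspose_sub, conjTranspose_one, hP.eq]
      have hQQ : (1 - P) * (1 - P) = 1 - P := by
        rw [Matrix.mul_sub, Matrix.sub_mul, Matrix.sub_mul, hPP]; simp
      rw [trace_add, htr, trace_krausMap, sum_replaceKraus hρ hH hQQ, ← trace_add,
        ← Matrix.add_mul, add_sub_cancel, Matrix.one_mul]
  refine ⟨_, hch, ?_⟩
  have hψ := canonicalPurification_purifies hρ.1
  have hψ1 := star_dotProduct_of_purifies hρ _ hψ
  set ψ := canonicalPurification ρ
  have hσ := ampliation_posSemidef (R := A) hN.2 (ketbra_posSemidef ψ)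
  have h1 := (entanglementFidelity_eq hρ (isLinearMap_comp hD hN.1)
    (IsCompletelyPositive.comp hcp hN.2) ψ hψ).2
  have h2 := (entanglementFidelity_eq hρ (hch.comp hN).1 (hch.comp hN).2 ψ hψ).2
  have h3 : ampliation ((fun X => D X + c X) ∘ N) (ketbra ψ ψ) =
      ampliation (D ∘ N) (ketbra ψ ψ) + ampliation c (ampliation N (ketbra ψ ψ)) := rfl
  -- The added positive term cannot lower the overlap with `ψ`, and the overlap is at most the
  -- trace, which is one.
  have h4 := (Complex.nonneg_iff.1
    ((ampliation_posSemidef hc2 hσ).dotProduct_mulVec_nonneg ψ)).1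
  have h5 := dotProduct_mulVec_le_trace hψ1
    (ampliation_posSemidef (R := A) (hch.comp hN).2 (ketbra_posSemidef ψ))
  rw [trace_ampliation (hch.comp hN), trace_ketbra, hψ1, Complex.one_re, ← h2] at h5
  rw [h3, add_mulVec, dotProduct_add, Complex.add_re, ← h1, hF] at h2
  linarith

end Completion

/-! ### Rotated Petz maps -/

section Petz

variable {A B R E : Type*} [Fintype A] [DecidableEq A] [Fintype B] [DecidableEq B]
  [Fintype R] [DecidableEq R] [Fintype E] [DecidableEq E]

/-- Kraus operators of the rotated Petz map. -/
def petzKraus (ρ : Matrix A A ℂ) (K : E → Matrix B A ℂ) (t : ℝ) (e : E) : Matrix A B ℂ :=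
  cpow ρ (1 / 2 - Complex.I * t) * (K e)ᴴ * cpow (krausMap K ρ) (-1 / 2 + Complex.I * t)

theorem krausMap_posSemidef {ρ : Matrix A A ℂ} (hρ : ρ.PosSemidef) (K : E → Matrix B A ℂ) :
    (krausMap K ρ).PosSemidef :=
  posSemidef_sum _ fun _ _ => hρ.mul_mul_conjTranspose_same _

theorem rotatedPetz_krausMap {ρ : Matrix A A ℂ} (hρ : ρ.PosSemidef) (K : E → Matrix B A ℂ)
    (t : ℝ) : rotatedPetz ρ (krausMap K) t = krausMap (petzKraus ρ K t) := by
  funext X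
  have h1 : star (1 / 2 - Complex.I * t) = 1 / 2 + Complex.I * t := by
    apply Complex.ext <;> simp
  have h2 : star (-1 / 2 + Complex.I * t) = -1 / 2 - Complex.I * t := by
    apply Complex.ext <;> simp
  simp only [rotatedPetz, adjointMap_krausMap, krausMap, petzKraus, conjTranspose_mul,
    conjTranspose_conjTranspose, cpow_conjTranspose hρ, h1, Matrix.mul_sum, Matrix.sum_mul]
  have h3 := cpow_conjTranspose (krausMap_posSemidef hρ K) (-1 / 2 + Complex.I * t)
  rw [h2] at h3
  refine Finset.sum_congr rfl fun e _ => ?_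
  rw [krausMap] at h3
  rw [h3]
  simp only [Matrix.mul_assoc]

theorem petzDecoder_eq_rotatedPetz {ρ : Matrix A A ℂ} (hρ : ρ.PosSemidef)
    {N : Matrix A A ℂ → Matrix B B ℂ} (hN : (N ρ).PosSemidef) :
    petzDecoder ρ N = rotatedPetz ρ N 0 := by
  funext X
  simp only [petzDecoder, rotatedPetz, rpow_eq_cpow hρ, rpow_eq_cpow hN]
  simp

/-- The outer powers of `N(ρ)` have exponents adding up to `-1`, leaving the support projection. It
does not depend on `t`, so averaging over `t` keeps it. -/
theorem sum_petzKraus {ρ : Matrix A A ℂ} (hρ : ρ.PosSemidef) (K : E → Matrix B A ℂ) (t : ℝ) :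
    ∑ e, (petzKraus ρ K t e)ᴴ * petzKraus ρ K t e = cpow (krausMap K ρ) 0 := by
  have hs := krausMap_posSemidef hρ K
  set z := -1 / 2 + Complex.I * t
  have h (e : E) : (petzKraus ρ K t e)ᴴ * petzKraus ρ K t e =
      (cpow (krausMap K ρ) z)ᴴ * (K e * ρ * (K e)ᴴ) * cpow (krausMap K ρ) z := by
    have h1 : (cpow ρ (1 / 2 - Complex.I * t))ᴴ * cpow ρ (1 / 2 - Complex.I * t) = ρ := by
      rw [cpow_conjTranspose hρ, cpow_mul_cpow hρ.1]
      conv_rhs => rw [← cpow_one hρ.1]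
      congr 1
      apply Complex.ext <;> norm_num
    have h2 : K e * ρ * (K e)ᴴ = K e * ((cpow ρ (1 / 2 - Complex.I * t))ᴴ *
        cpow ρ (1 / 2 - Complex.I * t)) * (K e)ᴴ := by rw [h1]
    rw [h2]
    simp only [petzKraus, conjTranspose_mul, conjTranspose_conjTranspose, Matrix.mul_assoc, z]
  simp only [h, ← Matrix.mul_sum, ← Matrix.sum_mul]
  rw [show ∑ e, K e * ρ * (K e)ᴴ = krausMap K ρ from rfl, cpow_conjTranspose hs]
  conv_lhs => enter [1, 2]; rw [← cpow_one hs.1]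
  rw [cpow_mul_cpow hs.1, cpow_mul_cpow hs.1]
  congr 1
  apply Complex.ext <;> norm_num [z]

theorem cpow_zero_isHermitian {X : Matrix A A ℂ} (hX : X.PosSemidef) :
    (cpow X 0).IsHermitian := by
  rw [Matrix.IsHermitian, cpow_conjTranspose hX, star_zero]

theorem cpow_zero_mul_self {X : Matrix A A ℂ} (hX : X.PosSemidef) :
    cpow X 0 * cpow X 0 = cpow X 0 := by
  rw [cpow_mul_cpow hX.1, add_zero]

/-- The operator from `A ⊗ E` to `B` with blocks `K_e ρ^{1/2}`. -/
def blockKraus (ρ : Matrix A A ℂ) (K : E → Matrix B A ℂ) : Matrix B (A × E) ℂ :=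
  Matrix.of fun b i => (K i.2 * rpow ρ (1 / 2)) b i.1

theorem vecToMatrix_canonicalPurification (ρ : Matrix A A ℂ) :
    vecToMatrix (canonicalPurification ρ) = rpow ρ (1 / 2) := rfl

theorem blockKraus_mul_conjTranspose {ρ : Matrix A A ℂ} (hρ : ρ.PosSemidef)
    (K : E → Matrix B A ℂ) : blockKraus ρ K * (blockKraus ρ K)ᴴ = krausMap K ρ := by
  have h (e : E) : K e * ρ * (K e)ᴴ = (K e * rpow ρ (1 / 2)) * (K e * rpow ρ (1 / 2))ᴴ := by
    conv_lhs => rw [← rpow_half_mul_self hρ]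
    rw [conjTranspose_mul, (rpow_half_isHermitian ρ).eq]
    simp only [Matrix.mul_assoc]
  simp only [krausMap, h]
  ext b b'
  rw [mul_apply, Fintype.sum_prod_type_right, Matrix.sum_apply]
  refine Finset.sum_congr rfl fun e _ => ?_
  rw [mul_apply]
  rfl

theorem blockKraus_conjTranspose_mul_mul (ρ : Matrix A A ℂ) (K : E → Matrix B A ℂ)
    (Q : Matrix B B ℂ) (i j : A × E) :
    ((blockKraus ρ K)ᴴ * (Q * blockKraus ρ K)) i j =
      ((K i.2 * rpow ρ (1 / 2))ᴴ * (Q * (K j.2 * rpow ρ (1 / 2)))) i.1 j.1 := by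
  rw [mul_apply, mul_apply]
  refine Finset.sum_congr rfl fun b _ => ?_
  rw [mul_apply, mul_apply]
  rfl

/-- If the reference and the environment are decoupled, then the rotated Petz maps recover. -/
theorem ampliation_rotatedPetz {ρ : Matrix A A ℂ} (hρ : IsState ρ) {K : E → Matrix B A ℂ}
    (hN : IsChannel (krausMap K))
    (h : trMid (ketbra (krausVec K (canonicalPurification ρ))
        (krausVec K (canonicalPurification ρ))) =
      trSnd (trMid (ketbra (krausVec K (canonicalPurification ρ))
        (krausVec K (canonicalPurification ρ)))) ⊗ₖ
      trFst (trMid (ketbra (krausVec K (canonicalPurification ρ))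
        (krausVec K (canonicalPurification ρ))))) (t : ℝ) :
    ampliation (rotatedPetz ρ (krausMap K) t ∘ krausMap K)
      (ketbra (canonicalPurification ρ) (canonicalPurification ρ)) =
      ketbra (canonicalPurification ρ) (canonicalPurification ρ) := by
  have hρ0 := hρ.1
  have hS := (rpow_half_isHermitian ρ).eq
  have hSc : rpow ρ (1 / 2) = cpow ρ (1 / 2) := by
    rw [rpow_eq_cpow hρ0]; congr 1; simp
  set τ := trMid (ketbra (krausVec K (canonicalPurification ρ))
    (krausVec K (canonicalPurification ρ))) with hτ
  have hsnd : trSnd τ = ρᵀ := by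
    rw [hτ, trSnd_trMid, trSnd_krausVec, trSnd_ampliation hN, trSnd_ketbra,
      vecToMatrix_canonicalPurification, hS, rpow_half_mul_self hρ0]
  have hψ1 := star_dotProduct_of_purifies hρ _ (canonicalPurification_purifies hρ0)
  have hτ1 : τ.trace = 1 := by
    rw [hτ, trace_trMid, ← trace_trSnd, trSnd_krausVec, trace_ampliation hN, trace_ketbra, hψ1]
  set γ := (trFst τ)ᵀ with hγ
  have hγ0 : γ.PosSemidef :=
    (trFst_posSemidef (trMid_posSemidef (ketbra_posSemidef _))).transpose
  have hγ1 : γ.trace = 1 := by rw [hγ, trace_transpose, trace_trFst, hτ1]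
  set L := blockKraus ρ K with hL
  -- `Lᴴ * L` is the transpose of the state of `RE`; decoupling enters here.
  have hLL : Lᴴ * L = ρ ⊗ₖ γ := by
    have h1 : Lᴴ * L = τᵀ := by
      ext i j
      simp only [mul_apply, conjTranspose_apply, hτ, trMid, ketbra, vecMulVec_apply, transpose_apply,
        of_apply, krausVec, hL, blockKraus, vecToMatrix_canonicalPurification, Pi.star_apply]
      exact Finset.sum_congr rfl fun b _ => mul_comm _ _
    rw [h1, h, hsnd, ← kroneckerMap_transpose, transpose_transpose]
  have hLpos := (posSemidef_conjTranspose_mul_self L).1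
  set w := -1 / 2 + Complex.I * t with hw
  have hw1 : 1 + w = 1 / 2 + Complex.I * t := by rw [hw]; ring
  -- `L` turns the power of `L * Lᴴ = N(ρ)` into the same power of `Lᴴ * L`, and the outer `Lᴴ`
  -- raises the exponent by one.
  have hpow : Lᴴ * (cpow (krausMap K ρ) w * L) = cpow ρ (1 + w) ⊗ₖ cpow γ (1 + w) := by
    rw [← blockKraus_mul_conjTranspose hρ0, ← hL,
      cpow_mul_of_intertwine (posSemidef_self_mul_conjTranspose L).1 hLpos
        (Matrix.mul_assoc L Lᴴ L), ← Matrix.mul_assoc]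
    conv_lhs => enter [1]; rw [← cpow_one hLpos]
    rw [cpow_mul_cpow hLpos, hLL, cpow_kronecker hρ0 hγ0]
  have hblock (e f : E) : (K e * rpow ρ (1 / 2))ᴴ * (cpow (krausMap K ρ) w *
      (K f * rpow ρ (1 / 2))) = cpow γ (1 + w) e f • cpow ρ (1 + w) := by
    ext r r'
    have := congrFun (congrFun hpow (r, e)) (r', f)
    rw [hL, blockKraus_conjTranspose_mul_mul] at this
    rw [this]
    simp [mul_comm]
  -- The factor `ρ^(1/2 - it)` of the decoder supplies the `ρ^(1/2)` of the left block and a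
  -- rotation `ρ^(-it)`, which cancels the one in `ρ^(1/2 + it)`.
  have hfix (i : E × E) : petzKraus ρ K t i.1 * K i.2 * rpow ρ (1 / 2) =
      cpow γ (1 + w) i.1 i.2 • rpow ρ (1 / 2) := by
    have h1 : cpow ρ (1 / 2 - Complex.I * t) = cpow ρ (-Complex.I * t) * rpow ρ (1 / 2) := by
      rw [hSc, cpow_mul_cpow hρ0.1]
      congr 1
      ring
    have h2 : cpow ρ (-Complex.I * t) * cpow ρ (1 + w) = rpow ρ (1 / 2) := by
      rw [hSc, cpow_mul_cpow hρ0.1, hw1]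
      congr 1
      ring
    rw [← h2, ← Matrix.mul_smul, ← hblock, petzKraus, h1, conjTranspose_mul, hS]
    simp only [Matrix.mul_assoc]
    rw [h2]
  rw [rotatedPetz_krausMap hρ0, krausMap_comp]
  refine ampliation_krausMap_of_fixed (c := fun i : E × E => cpow γ (1 + w) i.1 i.2)
    (fun i => ?_) ?_
  · rw [vecToMatrix_canonicalPurification, hfix]
  -- The scalars are the entries of `γ^(1/2 + it)`, whose squared Hilbert-Schmidt norm is `tr γ =
  -- 1`.
  · have h1 : cpow γ (1 + w) * (cpow γ (1 + w))ᴴ = γ := by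
      have h2 : 1 + w + star (1 + w) = 1 := by
        apply Complex.ext <;> norm_num [hw]
      rw [cpow_conjTranspose hγ0, cpow_mul_cpow hγ0.1, h2, cpow_one hγ0.1]
    have h2 : ∑ i : E × E, cpow γ (1 + w) i.1 i.2 * star (cpow γ (1 + w) i.1 i.2) =
        (cpow γ (1 + w) * (cpow γ (1 + w))ᴴ).trace := by
      simp only [Matrix.trace, diag_apply, mul_apply, conjTranspose_apply, Fintype.sum_prod_type]
    rw [h2, h1, hγ1]

end Petz

/-! ### The density `β₀` -/

theorem beta0_nonneg (t : ℝ) : 0 ≤ beta0 t := by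
  have := Real.cosh_pos (Real.pi * t)
  have := Real.pi_pos
  unfold beta0
  positivity

/-- `β₀` is the logistic density `π exp(π t) / (exp(π t) + 1)²`; this primitive runs from `-1` to
`0`. -/
theorem hasDerivAt_beta0_primitive (t : ℝ) :
    HasDerivAt (fun t => -(Real.exp (Real.pi * t) + 1)⁻¹) (beta0 t) t := by
  have h0 : Real.exp (Real.pi * t) + 1 ≠ 0 := by positivity
  have h1 : HasDerivAt (fun t => Real.exp (Real.pi * t) + 1) (Real.exp (Real.pi * t) * Real.pi) t :=
    (((hasDerivAt_id t).const_mul Real.pi).exp.add_const 1).congr_deriv (by simp)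
  refine (h1.inv h0).neg.congr_deriv ?_
  have hc := Real.cosh_pos (Real.pi * t)
  have he := Real.exp_pos (Real.pi * t)
  rw [beta0, Real.cosh_eq, Real.exp_neg]
  field_simp
  ring

open Filter Topology in
theorem tendsto_beta0_primitive_atTop :
    Tendsto (fun t => -(Real.exp (Real.pi * t) + 1)⁻¹) atTop (𝓝 0) := by
  have h : Tendsto (fun t => Real.exp (Real.pi * t) + 1) atTop atTop :=
    tendsto_atTop_add_const_right _ _
      (Real.tendsto_exp_atTop.comp (tendsto_id.const_mul_atTop Real.pi_pos))
  simpa using (tendsto_inv_atTop_zero.comp h).neg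

open Filter Topology in
theorem tendsto_beta0_primitive_atBot :
    Tendsto (fun t => -(Real.exp (Real.pi * t) + 1)⁻¹) atBot (𝓝 (-1)) := by
  have h : Tendsto (fun t => Real.exp (Real.pi * t) + 1) atBot (𝓝 (0 + 1)) :=
    (Real.tendsto_exp_atBot.comp (tendsto_id.const_mul_atBot Real.pi_pos)).add_const 1
  have := (h.inv₀ (by norm_num)).neg
  simpa using this

/-- On the right half-line a nonnegative derivative with convergent primitive is integrable;
evenness gives the left half-line. -/
theorem integrable_beta0 : Integrable beta0 := by
  have h1 : IntegrableOn beta0 (Set.Ioi 0) :=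
    integrableOn_Ioi_deriv_of_nonneg' (fun t _ => hasDerivAt_beta0_primitive t)
      (fun t _ => beta0_nonneg t) tendsto_beta0_primitive_atTop
  have h2 : IntegrableOn beta0 (Set.Iic 0) := by
    have h3 := (integrableOn_Ici_iff_integrableOn_Ioi).2 h1
    rw [← neg_zero] at h3
    have h4 := h3.comp_neg_Iic
    have h5 : (fun t => beta0 (-t)) = beta0 := by
      funext t
      simp [beta0]
    rwa [h5] at h4
  rw [← integrableOn_univ, ← Set.Iic_union_Ioi (a := (0 : ℝ))]
  exact h2.union h1

theorem integral_beta0 : ∫ t, beta0 t = 1 := by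
  rw [integral_of_hasDerivAt_of_tendsto hasDerivAt_beta0_primitive integrable_beta0
    tendsto_beta0_primitive_atBot tendsto_beta0_primitive_atTop]
  norm_num

/-! ### Averages of Kraus maps -/

/-- Bounded continuous functions. -/
def IsBoundedContinuous (f : ℝ → ℂ) : Prop := Continuous f ∧ ∃ C, ∀ t, ‖f t‖ ≤ C

namespace IsBoundedContinuous

theorem const (c : ℂ) : IsBoundedContinuous fun _ => c := ⟨continuous_const, ‖c‖, fun _ => le_rfl⟩

theorem mul {f g : ℝ → ℂ} (hf : IsBoundedContinuous f) (hg : IsBoundedContinuous g) :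
    IsBoundedContinuous fun t => f t * g t := by
  obtain ⟨hf, C, hC⟩ := hf
  obtain ⟨hg, D, hD⟩ := hg
  refine ⟨hf.mul hg, C * D, fun t => ?_⟩
  rw [norm_mul]
  exact mul_le_mul (hC t) (hD t) (norm_nonneg _) ((norm_nonneg _).trans (hC t))

theorem sum {ι : Type*} [Fintype ι] {f : ι → ℝ → ℂ} (hf : ∀ i, IsBoundedContinuous (f i)) :
    IsBoundedContinuous fun t => ∑ i, f i t := by
  choose h C hC using hf
  exact ⟨continuous_finsetSum _ fun i _ => h i, ∑ i, C i, fun t =>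
    (norm_sum_le _ _).trans (Finset.sum_le_sum fun i _ => hC i t)⟩

theorem star {f : ℝ → ℂ} (hf : IsBoundedContinuous f) : IsBoundedContinuous fun t => star (f t) :=
  ⟨hf.1.star, hf.2.imp fun C hC t => by simpa using hC t⟩

theorem integrable_mul {f : ℝ → ℂ} (hf : IsBoundedContinuous f) {w : ℝ → ℝ} (hw : Integrable w) :
    Integrable fun t => (w t : ℂ) * f t := by
  obtain ⟨hc, C, hC⟩ := hf
  exact hw.ofReal.mul_bdd (c := C) hc.aestronglyMeasurable (.of_forall hC)

theorem matrix_mul {l m n : Type*} [Fintype m] {M : ℝ → Matrix l m ℂ} {M' : ℝ → Matrix m n ℂ}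
    (h : ∀ i j, IsBoundedContinuous fun t => M t i j)
    (h' : ∀ i j, IsBoundedContinuous fun t => M' t i j) (i : l) (j : n) :
    IsBoundedContinuous fun t => (M t * M' t) i j := by
  simp only [mul_apply]
  exact sum fun k => (h i k).mul (h' k j)

end IsBoundedContinuous

section Average

variable {A B E : Type*} [Fintype A] [DecidableEq A] [Fintype B] [DecidableEq B]
  [Fintype E] [DecidableEq E]

/-- For `x > 0` the imaginary part of the exponent contributes only a phase, so `x ^ a` bounds the
function for all `t`. -/
theorem isBoundedContinuous_suppCpow {x : ℝ} (hx : 0 ≤ x) (a b : ℝ) :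
    IsBoundedContinuous fun t => suppCpow (a + Complex.I * ((b * t : ℝ) : ℂ)) x := by
  rcases hx.eq_or_lt with h | h
  · simpa [suppCpow, ← h] using IsBoundedContinuous.const 0
  · simp only [suppCpow, h.ne', if_false]
    refine ⟨Continuous.const_cpow (by fun_prop) (.inl (by exact_mod_cast h.ne')), x ^ a,
      fun t => ?_⟩
    rw [Complex.norm_cpow_eq_rpow_re_of_pos h]
    simp

theorem isBoundedContinuous_cpow {X : Matrix A A ℂ} (hX : X.PosSemidef) (a b : ℝ) (i j : A) :
    IsBoundedContinuous fun t => cpow X (a + Complex.I * ((b * t : ℝ) : ℂ)) i j := by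
  obtain ⟨U, hU, d, hd, rfl⟩ := exists_conjDiag_nonneg hX
  simp only [cpow_conjDiag hU]
  simp only [conjDiag]
  let D : ℝ → Matrix A A ℂ := fun t =>
    diagonal fun k => suppCpow (a + Complex.I * ((b * t : ℝ) : ℂ)) (d k)
  refine IsBoundedContinuous.matrix_mul (M := fun t => U * D t) (M' := fun _ => Uᴴ)
    (IsBoundedContinuous.matrix_mul (M := fun _ => U) (M' := D) (fun _ _ => .const _) fun k l => ?_)
    (fun _ _ => .const _) i j
  by_cases h : k = l
  · subst h
    simpa [D] using isBoundedContinuous_suppCpow (hd k) a b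
  · simpa [D, diagonal_apply_ne _ h] using IsBoundedContinuous.const 0

theorem isBoundedContinuous_krausMap {G : ℝ → E → Matrix A B ℂ}
    (hG : ∀ e i j, IsBoundedContinuous fun t => G t e i j) (X : Matrix B B ℂ) (i j : A) :
    IsBoundedContinuous fun t => krausMap (G t) X i j := by
  simp only [krausMap_apply]
  exact .sum fun e => .sum fun a => .sum fun a' => ((hG e i a).mul (.const _)).mul (hG e j a').star

theorem posSemidef_integral {n : Type*} [Fintype n] {M : ℝ → Matrix n n ℂ}
    (hM : ∀ t, (M t).PosSemidef) (hint : ∀ i j, Integrable fun t => M t i j) :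
    (Matrix.of fun i j => ∫ t, M t i j).PosSemidef := by
  refine PosSemidef.of_dotProduct_mulVec_nonneg ?_ fun x => ?_
  · ext i j
    simp only [conjTranspose_apply, of_apply]
    rw [← starRingEnd_apply, ← integral_conj]
    refine integral_congr_ae (.of_forall fun t => ?_)
    exact (hM t).1.apply i j
  · have h : star x ⬝ᵥ ((Matrix.of fun i j => ∫ t, M t i j) *ᵥ x) =
        ∫ t, star x ⬝ᵥ (M t *ᵥ x) := by
      simp only [dotProduct, mulVec, of_apply]
      rw [integral_finsetSum _ fun i _ => (integrable_finsetSum _ fun j _ =>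
        (hint i j).mul_const _).const_mul _]
      refine Finset.sum_congr rfl fun i _ => ?_
      rw [integral_const_mul, integral_finsetSum _ fun j _ => (hint i j).mul_const _]
      simp only [integral_mul_const]
    rw [h]
    exact integral_nonneg fun t => (hM t).dotProduct_mulVec_nonneg x

/-- The average of a family of Kraus maps, with weight `w`. -/
def averageMap (w : ℝ → ℝ) (G : ℝ → E → Matrix A B ℂ) (X : Matrix B B ℂ) : Matrix A A ℂ :=
  Matrix.of fun i j => ∫ t, (w t : ℂ) * krausMap (G t) X i j

variable {w : ℝ → ℝ} {G : ℝ → E → Matrix A B ℂ}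

theorem averageMap_isLinearMap (hw : Integrable w)
    (hG : ∀ e i j, IsBoundedContinuous fun t => G t e i j) : IsLinearMap ℂ (averageMap w G) where
  map_add X Y := by
    ext i j
    simp only [averageMap, of_apply, Matrix.add_apply, (krausMap_isLinearMap _).map_add, mul_add]
    exact integral_add ((isBoundedContinuous_krausMap hG X i j).integrable_mul hw)
      ((isBoundedContinuous_krausMap hG Y i j).integrable_mul hw)
  map_smul c X := by
    ext i j
    simp only [averageMap, of_apply, Matrix.smul_apply, (krausMap_isLinearMap _).map_smul,
      smul_eq_mul, mul_left_comm _ c]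
    exact integral_const_mul _ _

theorem averageMap_isCompletelyPositive (hw : Integrable w) (hw0 : ∀ t, 0 ≤ w t)
    (hG : ∀ e i j, IsBoundedContinuous fun t => G t e i j) :
    IsCompletelyPositive (averageMap w G) := by
  intro n X hX
  exact posSemidef_integral (M := fun t => (w t : ℂ) • ampliation (krausMap (G t)) X)
    (fun t => (krausMap_isCompletelyPositive (G t) n X hX).smul (by simpa using hw0 t))
    fun i j => (isBoundedContinuous_krausMap hG _ _ _).integrable_mul hw

theorem trace_averageMap (hw : Integrable w) (hw1 : ∫ t, w t = 1)
    (hG : ∀ e i j, IsBoundedContinuous fun t => G t e i j) {P : Matrix B B ℂ}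
    (hP : ∀ t, ∑ e, (G t e)ᴴ * G t e = P) (X : Matrix B B ℂ) :
    (averageMap w G X).trace = (P * X).trace := by
  simp only [averageMap, Matrix.trace, diag_apply, of_apply]
  rw [← integral_finsetSum _ fun i _ => (isBoundedContinuous_krausMap hG X i i).integrable_mul hw]
  have h (t : ℝ) : ∑ i, (w t : ℂ) * krausMap (G t) X i i = w t * (P * X).trace := by
    rw [← hP t, ← trace_krausMap, Matrix.trace, Finset.mul_sum]
    rfl
  simp only [h]
  have h1 : ∫ t, (w t : ℂ) = 1 := by
    rw [integral_complex_ofReal, hw1, Complex.ofReal_one]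
  rw [integral_mul_const, h1, one_mul, Matrix.trace]
  rfl

theorem isBoundedContinuous_petzKraus {ρ : Matrix A A ℂ} (hρ : ρ.PosSemidef)
    (K : E → Matrix B A ℂ) (e : E) (i : A) (j : B) :
    IsBoundedContinuous fun t => petzKraus ρ K (t / 2) e i j := by
  have h1 (t : ℝ) : (1 / 2 - Complex.I * ((t / 2 : ℝ) : ℂ)) =
      ((1 / 2 : ℝ) : ℂ) + Complex.I * (((-1 / 2) * t : ℝ) : ℂ) := by
    push_cast; ring
  have h2 (t : ℝ) : (-1 / 2 + Complex.I * ((t / 2 : ℝ) : ℂ)) =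
      ((-1 / 2 : ℝ) : ℂ) + Complex.I * (((1 / 2) * t : ℝ) : ℂ) := by
    push_cast; ring
  simp only [petzKraus, h1, h2]
  let M : ℝ → Matrix A A ℂ := fun t =>
    cpow ρ (((1 / 2 : ℝ) : ℂ) + Complex.I * (((-1 / 2) * t : ℝ) : ℂ))
  let M' : ℝ → Matrix B B ℂ := fun t =>
    cpow (krausMap K ρ) (((-1 / 2 : ℝ) : ℂ) + Complex.I * (((1 / 2) * t : ℝ) : ℂ))
  exact IsBoundedContinuous.matrix_mul (M := fun t => M t * (K e)ᴴ) (M' := M')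
    (IsBoundedContinuous.matrix_mul (M := M) (M' := fun _ => (K e)ᴴ)
      (isBoundedContinuous_cpow hρ _ _) fun _ _ => .const _)
    (isBoundedContinuous_cpow (krausMap_posSemidef hρ K) _ _) i j

theorem twirledPetzDecoder_krausMap {ρ : Matrix A A ℂ} (hρ : ρ.PosSemidef)
    (K : E → Matrix B A ℂ) :
    twirledPetzDecoder ρ (krausMap K) = averageMap beta0 fun t => petzKraus ρ K (t / 2) := by
  funext X
  simp only [twirledPetzDecoder, averageMap, rotatedPetz_krausMap hρ]

/-- The entrywise integral commutes with ampliation by definition, and the integrand is a constant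
times a probability density. -/
theorem ampliation_twirledPetz {R : Type*} {ρ : Matrix A A ℂ} {N : Matrix A A ℂ → Matrix B B ℂ}
    {X : Matrix (R × A) (R × A) ℂ} (h : ∀ t, ampliation (rotatedPetz ρ N t ∘ N) X = X) :
    ampliation (twirledPetzDecoder ρ N ∘ N) X = X := by
  ext i j
  have h1 : ampliation (twirledPetzDecoder ρ N ∘ N) X i j =
      ∫ t, (beta0 t : ℂ) * ampliation (rotatedPetz ρ N (t / 2) ∘ N) X i j := rfl
  simp only [h1, h]
  have h2 : ∫ t, (beta0 t : ℂ) = 1 := by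
    rw [integral_complex_ofReal, integral_beta0, Complex.ofReal_one]
  rw [integral_mul_const, h2, one_mul]

end Average

/-! ### The Schumacher-Westmoreland decoder -/

section SchumacherWestmoreland

variable {A B : Type*} [Fintype A] [DecidableEq A] [Fintype B] [DecidableEq B]
  {ρ : Matrix A A ℂ} {N : Matrix A A ℂ → Matrix B B ℂ}

/-- The matrix whose columns are the vectors of an orthonormal basis. -/
def basisMatrix {n : Type*} [Fintype n] (b : OrthonormalBasis n ℂ (EuclideanSpace ℂ n)) :
    Matrix n n ℂ :=
  Matrix.of fun i j => b j i

theorem basisMatrix_mem_unitaryGroup {n : Type*} [Fintype n] [DecidableEq n]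
    (b : OrthonormalBasis n ℂ (EuclideanSpace ℂ n)) : basisMatrix b ∈ unitaryGroup n ℂ := by
  refine mem_unitaryGroup_of_conjTranspose_mul ?_
  ext i j
  have := orthonormal_iff_ite.1 b.orthonormal i j
  simp only [PiLp.inner_apply, RCLike.inner_apply] at this
  simp only [mul_apply, conjTranspose_apply, basisMatrix, of_apply, one_apply, ← this]
  exact Finset.sum_congr rfl fun k _ => mul_comm _ _

theorem sum_smul_ketbra {m n : Type*} [Fintype n] [DecidableEq n] (M : Matrix m n ℂ) (d : n → ℂ) :
    ∑ i, d i • ketbra (fun x => M x i) (fun x => M x i) = M * diagonal d * Mᴴ := by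
  ext x y
  rw [mul_apply]
  simp only [Matrix.sum_apply, Matrix.smul_apply, ketbra, vecMulVec_apply,
    mul_diagonal, conjTranspose_apply, smul_eq_mul, Pi.star_apply]
  exact Finset.sum_congr rfl fun i _ => by ring

namespace SWPurification

variable (P : SWPurification ρ N)

/-- The Kraus operators of `N` given by the Stinespring isometry. -/
def stinespringKraus (f : A × B) : Matrix B A ℂ := Matrix.of fun b a => P.V (b, f) a

theorem eq_krausMap : N = krausMap P.stinespringKraus := by
  funext X
  rw [P.V_dilates X]
  ext b b'
  rw [krausMap_apply]
  simp only [trSnd, of_apply, mul_apply, conjTranspose_apply, Finset.sum_mul, stinespringKraus]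
  exact Finset.sum_congr rfl fun f _ => Finset.sum_comm

theorem sigmaVec_eq_krausVec : P.sigmaVec = krausVec P.stinespringKraus P.rhoVec := by
  funext i
  simp only [sigmaVec, krausVec, mul_apply, stinespringKraus, vecToMatrix, of_apply]

/-- The channel leaves the reference untouched, so the Schmidt decomposition of the purification
diagonalises `σ_R`. -/
theorem sigmaR_eq (hN : IsChannel N) :
    P.sigmaR = conjDiag (basisMatrix P.r) fun k => (P.lam k : ℂ) := by
  have h1 : P.sigmaR = trSnd (ketbra P.rhoVec P.rhoVec) := by
    have hN' := hN
    rw [P.eq_krausMap] at hN'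
    rw [sigmaR, sigmaRE, trSnd_trMid, sigmaVec_eq_krausVec, trSnd_krausVec, trSnd_ampliation hN']
  have hA : (Matrix.of fun (x : A) k => P.a k x)ᴴ * (Matrix.of fun (x : A) k => P.a k x) = 1 := by
    ext i j
    have := orthonormal_iff_ite.1 P.a_orthonormal i j
    simp only [PiLp.inner_apply, RCLike.inner_apply] at this
    simp only [mul_apply, conjTranspose_apply, of_apply, one_apply, ← this]
    exact Finset.sum_congr rfl fun k _ => mul_comm _ _
  have h2 : vecToMatrix P.rhoVec = (Matrix.of fun (x : A) k => P.a k x) *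
      (diagonal fun k => (√(P.lam k) : ℂ)) * (basisMatrix P.r)ᵀ := by
    ext x k
    rw [mul_apply]
    simp only [vecToMatrix, rhoVec, of_apply, mul_diagonal, transpose_apply, basisMatrix]
    exact Finset.sum_congr rfl fun k _ => by ring
  have h3 : (diagonal fun k => (√(P.lam k) : ℂ))ᴴ * (diagonal fun k => (√(P.lam k) : ℂ)) =
      diagonal fun k => (P.lam k : ℂ) := by
    rw [(isHermitian_diagonal_ofReal _).eq, diagonal_mul_diagonal]
    congr 1
    funext k
    rw [← Complex.ofReal_mul, Real.mul_self_sqrt (P.lam_nonneg k)]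
  rw [h1, trSnd_ketbra]
  have h4 : (vecToMatrix P.rhoVec)ᴴ * vecToMatrix P.rhoVec =
      (basisMatrix P.r)ᵀᴴ * (diagonal fun k => (P.lam k : ℂ)) * (basisMatrix P.r)ᵀ := by
    rw [h2, conjTranspose_mul, conjTranspose_mul, ← h3]
    simp only [Matrix.mul_assoc]
    rw [← Matrix.mul_assoc (Matrix.of fun (x : A) k => P.a k x)ᴴ, hA, Matrix.one_mul]
  rw [h4, transpose_mul, transpose_mul, transpose_transpose, diagonal_transpose, conjDiag,
    ← Matrix.mul_assoc]
  rfl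

end SWPurification

namespace SWSpectral

variable (S : SWSpectral ρ N)

/-- The unitary with columns `|r_k⟩ ⊗ |e_l⟩`. -/
def phiMatrix : Matrix (Fin ρ.rank × (A × B)) (Fin ρ.rank × (A × B)) ℂ :=
  basisMatrix S.r ⊗ₖ basisMatrix S.e

theorem phiMatrix_mem_unitaryGroup : S.phiMatrix ∈ unitaryGroup (Fin ρ.rank × (A × B)) ℂ :=
  kronecker_mem_unitaryGroup (basisMatrix_mem_unitaryGroup _) (basisMatrix_mem_unitaryGroup _)

theorem sigmaE_eq : S.sigmaE = conjDiag (basisMatrix S.e) fun l => (S.mu l : ℂ) := by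
  rw [S.spectral]
  exact sum_smul_ketbra (basisMatrix S.e) fun l => (S.mu l : ℂ)

/-- The symmetric unitary relating the basis `|r_k⟩ ⊗ |e_l⟩` to its complex conjugate. -/
def symUnitary : Matrix (Fin ρ.rank × (A × B)) (Fin ρ.rank × (A × B)) ℂ :=
  S.phiMatrix * S.phiMatrixᵀ

theorem symUnitary_mem_unitaryGroup : S.symUnitary ∈ unitaryGroup (Fin ρ.rank × (A × B)) ℂ :=
  mul_mem S.phiMatrix_mem_unitaryGroup (transpose_mem_unitaryGroup S.phiMatrix_mem_unitaryGroup)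

theorem symUnitary_transpose : S.symUnitaryᵀ = S.symUnitary := by
  rw [symUnitary, transpose_mul, transpose_transpose]

/-- Reshaped into a matrix, `∑ |φ_{k,l}⟩ ⊗ |φ_{k,l}⟩` is `Φ Φᵀ` rather than the identity;
`symUnitary` records this dependence on the basis. -/
theorem psiVec_eq (x y : Fin ρ.rank × (A × B)) :
    S.psiVec (x, y) = (rpow S.sigmaRE (1 / 2) * S.symUnitary) x y := by
  rw [symUnitary, ← Matrix.mul_assoc, mul_apply, Fintype.sum_prod_type]
  rfl

/-- Transposition in the basis `|φ_{k,l}⟩` is ordinary transposition conjugated by `Φ Φᵀ`. -/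
theorem opM_eq : S.opM = S.symUnitary * S.rootProductᵀ * S.symUnitaryᴴ := by
  have h1 : S.opM = S.phiMatrix * (S.phiMatrixᴴ * S.rootProduct * S.phiMatrix)ᵀ * S.phiMatrixᴴ := by
    have h2 (p q : Fin ρ.rank × (A × B)) :
        star (S.phi p.1 p.2) ⬝ᵥ (S.rootProduct *ᵥ S.phi q.1 q.2) =
          (S.phiMatrixᴴ * S.rootProduct * S.phiMatrix) p q := by
      rw [Matrix.mul_assoc, mul_apply]
      rfl
    ext x y
    have h3 : S.opM x y = ∑ p : Fin ρ.rank × (A × B), ∑ q : Fin ρ.rank × (A × B),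
        star (S.phi p.1 p.2) ⬝ᵥ (S.rootProduct *ᵥ S.phi q.1 q.2) *
          (S.phiMatrix x q * star (S.phiMatrix y p)) := by
      simp only [opM, Matrix.sum_apply, Matrix.smul_apply, smul_eq_mul, ketbra, vecMulVec_apply,
        Pi.star_apply]
      symm
      refine (Fintype.sum_prod_type _).trans (Finset.sum_congr rfl fun k _ => ?_)
      conv_rhs => rw [Finset.sum_comm]
      exact Finset.sum_congr rfl fun m _ => Fintype.sum_prod_type _
    rw [h3, mul_apply]
    refine Finset.sum_congr rfl fun p _ => ?_
    rw [mul_apply, Finset.sum_mul]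
    refine Finset.sum_congr rfl fun q _ => ?_
    rw [h2, transpose_apply, conjTranspose_apply]
    ring
  have h4 : S.phiMatrixᴴᵀ = S.phiMatrixᵀᴴ := rfl
  rw [h1, transpose_mul, transpose_mul, symUnitary, conjTranspose_mul, h4]
  simp only [Matrix.mul_assoc]

end SWSpectral

namespace SWConstruction

variable (C : SWConstruction ρ N)

/-- The embedding `|b⟩ ↦ |0⟩ ⊗ |b⟩` of `B` into `R' ⊗ (A' ⊗ B)`. -/
def embedding : Matrix (Fin ρ.rank × (A × B)) B ℂ :=
  Matrix.of fun y b => if y.2.2 = b then C.zero (y.1, y.2.1) else 0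

theorem embed_eq (X : Matrix B B ℂ) : C.embed X = C.embedding * X * C.embeddingᴴ := by
  ext y y'
  simp [embed, embedding, mul_apply, ketbra, vecMulVec_apply, apply_ite star]
  ring

theorem embedding_isometry : C.embeddingᴴ * C.embedding = 1 := by
  ext b b'
  have h := C.zero_unit
  simp only [dotProduct, Fintype.sum_prod_type, Pi.star_apply] at h
  by_cases hb : b = b'
  · subst hb
    simp only [mul_apply, conjTranspose_apply, embedding, of_apply, Fintype.sum_prod_type,
      apply_ite star, star_zero, ite_mul, zero_mul, Finset.sum_ite_eq', Finset.mem_univ, if_true,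
      mul_ite, mul_zero, one_apply_eq]
    simpa using h
  · rw [mul_apply, one_apply_ne hb]
    refine Finset.sum_eq_zero fun y _ => ?_
    simp only [conjTranspose_apply, embedding, of_apply]
    by_cases hy : y.2.2 = b
    · rw [if_neg (hy.trans_ne hb), mul_zero]
    · rw [if_neg hy, star_zero, zero_mul]

theorem opU_mem_unitaryGroup : C.opU ∈ unitaryGroup (Fin ρ.rank × (A × B)) ℂ :=
  mul_mem (conjTranspose_mem_unitaryGroup C.Utilde_unitary)
    (conjTranspose_mem_unitaryGroup C.Uhat_unitary)

theorem decoder_eq_krausMap : C.decoder = krausMap fun l => C.kraus l * C.embedding := by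
  funext X
  simp only [decoder, krausMap, embed_eq, conjTranspose_mul, Matrix.mul_assoc]

/-- The operator with columns `|a_k⟩`. -/
def aMatrix : Matrix A (Fin ρ.rank) ℂ := Matrix.of fun x k => C.a k x

theorem aMatrix_isometry : C.aMatrixᴴ * C.aMatrix = 1 := by
  ext i j
  have := orthonormal_iff_ite.1 C.a_orthonormal i j
  simp only [PiLp.inner_apply, RCLike.inner_apply] at this
  simp only [mul_apply, conjTranspose_apply, aMatrix, of_apply, one_apply, ← this]
  exact Finset.sum_congr rfl fun k _ => mul_comm _ _

/-- The operator with columns `|φ_{k,l}⟩`, for a fixed `l`. -/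
def phiBlock (l : A × B) : Matrix (Fin ρ.rank × (A × B)) (Fin ρ.rank) ℂ :=
  Matrix.of fun y k => C.phiMatrix y (k, l)

theorem kraus_eq (l : A × B) : C.kraus l = C.aMatrix * (C.phiBlock l)ᴴ * C.opU * C.W := by
  rw [kraus, ← Matrix.sum_mul, ← Matrix.sum_mul]
  congr 2
  ext x y
  simp only [Matrix.sum_apply, ketbra, vecMulVec_apply, Pi.star_apply, mul_apply,
    conjTranspose_apply]
  rfl

/-- The `|a_k⟩` are orthonormal, the `|φ_{k,l}⟩` resolve the identity, and `U W` is unitary. Unlike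
the Petz maps, this decoder needs no completion. -/
theorem decoder_isChannel : IsChannel C.decoder := by
  rw [decoder_eq_krausMap]
  refine krausMap_isChannel ?_
  have h1 (l : A × B) : (C.kraus l * C.embedding)ᴴ * (C.kraus l * C.embedding) =
      (C.opU * C.W * C.embedding)ᴴ * (C.phiBlock l * (C.phiBlock l)ᴴ) *
        (C.opU * C.W * C.embedding) := by
    rw [kraus_eq]
    simp only [conjTranspose_mul, conjTranspose_conjTranspose, Matrix.mul_assoc]
    rw [← Matrix.mul_assoc C.aMatrixᴴ, aMatrix_isometry, Matrix.one_mul]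
  have h2 : ∑ l, C.phiBlock l * (C.phiBlock l)ᴴ = 1 := by
    rw [← unitary_mul_conjTranspose C.phiMatrix_mem_unitaryGroup]
    ext y y'
    simp only [Matrix.sum_apply, mul_apply, Fintype.sum_prod_type_right, conjTranspose_apply,
      phiBlock, of_apply]
  have h3 : (C.opU * C.W)ᴴ * (C.opU * C.W) = 1 :=
    unitary_conjTranspose_mul (mul_mem C.opU_mem_unitaryGroup C.W_unitary)
  simp only [h1, ← Matrix.mul_sum, ← Matrix.sum_mul, h2, Matrix.mul_one]
  rw [conjTranspose_mul, Matrix.mul_assoc, ← Matrix.mul_assoc (C.opU * C.W)ᴴ, h3, Matrix.one_mul,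
    embedding_isometry]

/-- The vector `|σ⟩ ⊗ |0⟩` as an operator. -/
def sigmaZero : Matrix (Fin ρ.rank × (A × B)) (Fin ρ.rank × (A × B)) ℂ :=
  Matrix.of fun x y => C.sigmaVec ((x.1, y.2.2), x.2) * C.zero (y.1, y.2.1)

/-- The relation `|Ψ⟩ = W (|σ⟩ ⊗ |0⟩)` in matrix form: an operator on the second factor multiplies
on the right by its transpose. -/
theorem rpow_mul_symUnitary :
    rpow C.sigmaRE (1 / 2) * C.symUnitary = C.sigmaZero * C.Wᵀ := by
  ext x y
  rw [← C.psiVec_eq, C.W_spec, mul_apply]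
  exact Finset.sum_congr rfl fun z _ => mul_comm _ _

/-- In the decoupled case, `U` acts trivially on the support of `M`. -/
theorem rpow_mul_symUnitary_mul_opU (hρ : C.sigmaRE.PosSemidef)
    (h : C.sigmaRE = C.sigmaR ⊗ₖ C.sigmaE) :
    rpow C.sigmaRE (1 / 2) * C.symUnitary * C.opUᵀ = rpow C.sigmaRE (1 / 2) * C.symUnitary := by
  have hG := C.symUnitary_mem_unitaryGroup
  have hM : C.opM = C.symUnitary * C.sigmaREᵀ * C.symUnitaryᴴ := by
    rw [C.opM_eq, SWSpectral.rootProduct, ← h, rpow_half_mul_self hρ]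
  have hMpos : C.opM.PosSemidef := by
    rw [hM]
    exact hρ.transpose.mul_mul_conjTranspose_same _
  -- `U M = Ũᴴ Σ Ũ` is positive and, `U` being unitary, has the same square as the positive `M`;
  -- positive square roots are unique.
  have hUM : C.opU * C.opM = C.opM := by
    have hU1 := unitary_conjTranspose_mul C.Uhat_unitary
    have h1 : C.opU * C.opM = C.Utildeᴴ *
        (∑ k, ∑ l, (C.s k l : ℂ) • ketbra (C.phi k l) (C.phi k l)) * C.Utilde := by
      rw [C.svd, opU, Matrix.mul_assoc, ← Matrix.mul_assoc C.Uhatᴴ, ← Matrix.mul_assoc C.Uhatᴴ, hU1,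
        Matrix.one_mul, Matrix.mul_assoc]
    have h2 : (C.opU * C.opM).PosSemidef := by
      rw [h1]
      refine PosSemidef.conjTranspose_mul_mul_same ?_ _
      exact posSemidef_sum _ fun k _ => posSemidef_sum _ fun l _ =>
        (ketbra_posSemidef _).smul (by simpa using C.s_nonneg k l)
    refine eq_of_mul_self_eq h2 hMpos ?_
    nth_rewrite 1 [← h2.1.eq]
    rw [conjTranspose_mul, Matrix.mul_assoc, ← Matrix.mul_assoc C.opUᴴ,
      unitary_conjTranspose_mul C.opU_mem_unitaryGroup, Matrix.one_mul, hMpos.1.eq]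
  have h3 : C.opU * (C.symUnitary * C.sigmaREᵀ) = C.symUnitary * C.sigmaREᵀ := by
    have h4 : C.symUnitary * C.sigmaREᵀ = C.opM * C.symUnitary := by
      rw [hM, Matrix.mul_assoc, unitary_conjTranspose_mul hG, Matrix.mul_one]
    rw [h4, ← Matrix.mul_assoc, hUM]
  have h5 : C.sigmaRE * (C.symUnitary * C.opUᵀ - C.symUnitary) = 0 := by
    have := congrArg transpose h3
    simp only [transpose_mul, transpose_transpose, C.symUnitary_transpose] at this
    rw [Matrix.mul_sub, ← Matrix.mul_assoc, this, sub_self]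
  -- `σ_{RE}` and its square root have the same kernel.
  have h6 : rpow C.sigmaRE (1 / 2) * (C.symUnitary * C.opUᵀ - C.symUnitary) = 0 := by
    rw [← conjTranspose_mul_self_eq_zero, conjTranspose_mul, (rpow_half_isHermitian _).eq,
      Matrix.mul_assoc, ← Matrix.mul_assoc (rpow C.sigmaRE (1 / 2)), rpow_half_mul_self hρ, h5,
      Matrix.mul_zero]
  rwa [Matrix.mul_sub, sub_eq_zero, ← Matrix.mul_assoc] at h6

/-- Decoupling makes the product basis an eigenbasis of `σ_{RE}`, with eigenvalues `λ_k μ_l`. -/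
theorem rpow_mul_phiMatrix (hN : IsChannel N) (h : C.sigmaRE = C.sigmaR ⊗ₖ C.sigmaE) :
    rpow C.sigmaRE (1 / 2) * C.phiMatrix =
      C.phiMatrix * diagonal fun i => (√(C.lam i.1) * √(C.mu i.2) : ℂ) := by
  have hF := C.phiMatrix_mem_unitaryGroup
  have h1 : C.sigmaRE = conjDiag C.phiMatrix (fun i => ((√(C.lam i.1) * √(C.mu i.2) : ℝ) : ℂ)) *
      conjDiag C.phiMatrix (fun i => ((√(C.lam i.1) * √(C.mu i.2) : ℝ) : ℂ)) := by
    rw [conjDiag_mul_conjDiag hF, h, C.sigmaR_eq hN, C.sigmaE_eq, conjDiag_kronecker,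
      SWSpectral.phiMatrix]
    congr 1
    funext i
    rw [← Complex.ofReal_mul, ← Complex.ofReal_mul, mul_mul_mul_comm,
      Real.mul_self_sqrt (C.lam_nonneg _), Real.mul_self_sqrt (C.mu_nonneg _)]
  rw [h1, rpow_half_of_mul_self (conjDiag_posSemidef _ fun i => by positivity), conjDiag_mul hF]
  simp only [Complex.ofReal_mul]

/-- In the decoupled case, the Schumacher-Westmoreland decoder recovers. -/
theorem ampliation_decoder (hN : IsChannel N) (h : C.sigmaRE = C.sigmaR ⊗ₖ C.sigmaE) :
    ampliation (C.decoder ∘ N) (ketbra C.rhoVec C.rhoVec) = ketbra C.rhoVec C.rhoVec := by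
  have hpos : C.sigmaRE.PosSemidef := trMid_posSemidef (ketbra_posSemidef _)
  have hF := C.phiMatrix_mem_unitaryGroup
  -- Hence `U W (|σ⟩ ⊗ |0⟩) = ∑ √(λ_k μ_l) |r_k⟩ |e_l⟩ |φ_{k,l}⟩`: component `l` carries the Schmidt
  -- coefficients of `|ρ⟩` times `√μ_l`.
  have hS : C.sigmaZero * C.Wᵀ * C.opUᵀ * (C.phiMatrixᴴ)ᵀ =
      C.phiMatrix * diagonal fun i => (√(C.lam i.1) * √(C.mu i.2) : ℂ) := by
    rw [← rpow_mul_symUnitary, C.rpow_mul_symUnitary_mul_opU hpos h, SWSpectral.symUnitary,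
      Matrix.mul_assoc, Matrix.mul_assoc, ← transpose_mul, unitary_conjTranspose_mul hF,
      transpose_one, Matrix.mul_one, C.rpow_mul_phiMatrix hN h]
  have hιV (f : A × B) : C.embedding * (C.stinespringKraus f * vecToMatrix C.rhoVec) =
      Matrix.of fun y r => C.sigmaZeroᵀ y (r, f) := by
    ext y r
    have : (C.stinespringKraus f * vecToMatrix C.rhoVec) y.2.2 r = C.sigmaVec ((r, y.2.2), f) := by
      rw [C.sigmaVec_eq_krausVec]; rfl
    rw [mul_apply]
    simp only [embedding, of_apply, ite_mul, zero_mul, Finset.sum_ite_eq, Finset.mem_univ, if_true,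
      this, sigmaZero, transpose_apply]
    exact mul_comm _ _
  have hfix (i : (A × B) × (A × B)) :
      C.kraus i.1 * C.embedding * C.stinespringKraus i.2 * vecToMatrix C.rhoVec =
        (√(C.mu i.1) * C.e i.1 i.2 : ℂ) • vecToMatrix C.rhoVec := by
    obtain ⟨l, f⟩ := i
    have h1 : (C.phiBlock l)ᴴ * (C.opU * (C.W * Matrix.of fun y r => C.sigmaZeroᵀ y (r, f))) =
        Matrix.of fun k r => (C.phiMatrix * diagonal fun i : Fin ρ.rank × (A × B) =>
          (√(C.lam i.1) * √(C.mu i.2) : ℂ)) (r, f) (k, l) := by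
      ext k r
      rw [← hS, ← transpose_transpose C.sigmaZero, ← transpose_mul, ← transpose_mul, ← transpose_mul]
      rfl
    simp only [Matrix.mul_assoc]
    rw [hιV, kraus_eq]
    simp only [Matrix.mul_assoc]
    rw [h1]
    ext x r
    rw [mul_apply]
    simp only [aMatrix, of_apply, mul_diagonal, SWSpectral.phiMatrix, basisMatrix,
      kroneckerMap_apply, Matrix.smul_apply, vecToMatrix, SWPurification.rhoVec, smul_eq_mul,
      Finset.mul_sum]
    exact Finset.sum_congr rfl fun k _ => by ring
  have hcomp : C.decoder ∘ N = krausMap fun i : (A × B) × (A × B) =>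
      C.kraus i.1 * C.embedding * C.stinespringKraus i.2 := by
    rw [decoder_eq_krausMap]
    exact (congrArg (fun M => (krausMap fun l => C.kraus l * C.embedding) ∘ M)
      C.eq_krausMap).trans (krausMap_comp _ _)
  rw [hcomp]
  refine ampliation_krausMap_of_fixed hfix ?_
  -- The scalars `√μ_l e_l(f)` have total weight `∑ μ_l ‖e_l‖² = 1`.
  have hcol (l : A × B) : ∑ f, C.e l f * star (C.e l f) = 1 := by
    have := congrFun (congrFun
      (unitary_conjTranspose_mul (basisMatrix_mem_unitaryGroup C.e)) l) l
    simp only [mul_apply, conjTranspose_apply, basisMatrix, of_apply, one_apply_eq] at this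
    rw [← this]
    exact Finset.sum_congr rfl fun k _ => mul_comm _ _
  have hmu : ∑ l, (C.mu l : ℂ) = 1 := by exact_mod_cast C.mu_sum
  rw [Fintype.sum_prod_type, ← hmu]
  refine Finset.sum_congr rfl fun l _ => ?_
  rw [← mul_one (C.mu l : ℂ), ← hcol l, Finset.mul_sum]
  refine Finset.sum_congr rfl fun f _ => ?_
  have h2 : (√(C.mu l) : ℂ) * (√(C.mu l) : ℂ) = C.mu l := by
    rw [← Complex.ofReal_mul, Real.mul_self_sqrt (C.mu_nonneg l)]
  rw [← h2, star_mul', Complex.star_def, Complex.conj_ofReal]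
  ring

end SWConstruction

end SchumacherWestmoreland

/-! ### Existence of the Schumacher-Westmoreland construction -/

section Existence

variable {A B : Type*} [Fintype A] [DecidableEq A] [Fintype B] [DecidableEq B]
  {ρ : Matrix A A ℂ} {N : Matrix A A ℂ → Matrix B B ℂ}

theorem eq_conjDiag_eigenvectorBasis {n : Type*} [Fintype n] [DecidableEq n] {X : Matrix n n ℂ}
    (hX : X.IsHermitian) :
    X = conjDiag (basisMatrix hX.eigenvectorBasis) fun i => (hX.eigenvalues i : ℂ) := by
  conv_lhs => rw [hX.spectral_theorem, Unitary.conjStarAlgAut_apply]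
  rfl

/-- The number of nonzero eigenvalues is the rank, so they index the Schmidt decomposition; stacking
the `A × B` Kraus operators gives `V`. -/
theorem nonempty_swPurification (hρ : IsState ρ) (hN : IsChannel N) :
    Nonempty (SWPurification ρ N) := by
  have hH := hρ.1.1
  let ev := hH.eigenvalues
  let g : Fin ρ.rank ≃ {i // ev i ≠ 0} :=
    (Fintype.equivFinOfCardEq hH.rank_eq_card_non_zero_eigs.symm).symm
  have hsum (F : A → ℂ) : ∑ k, (ev (g k) : ℂ) * F (g k) = ∑ i, (ev i : ℂ) * F i := by
    rw [g.sum_comp fun i : {i // ev i ≠ 0} => (ev i : ℂ) * F i,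
      ← Finset.sum_subtype (Finset.univ.filter fun i => ev i ≠ 0) (by simp)
        fun i => (ev i : ℂ) * F i]
    refine Finset.sum_subset (Finset.filter_subset _ _) fun i _ hi => ?_
    have : ev i = 0 := by simpa using hi
    simp [this]
  obtain ⟨K, hK⟩ := exists_krausMap hN.1 hN.2
  have hK1 := sum_conjTranspose_mul_self_eq_one (K := K) (by rw [← hK]; exact hN.3)
  refine ⟨{ lam := fun k => ev (g k), lam_nonneg := fun k => hρ.1.eigenvalues_nonneg _,
            lam_sum := ?_, r := EuclideanSpace.basisFun _ ℂ,
            a := fun k => hH.eigenvectorBasis (g k)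
            a_orthonormal := hH.eigenvectorBasis.orthonormal.comp _
              (Subtype.val_injective.comp g.injective)
            purifies := ?_, V := Matrix.of fun i a => K i.2 i.1 a, V_isometry := ?_
            V_dilates := fun X => ?_ }⟩
  · have h1 := hsum fun _ => 1
    simp only [mul_one] at h1
    have h2 : ∑ i, (ev i : ℂ) = 1 := by
      rw [← hρ.2, hH.trace_eq_sum_eigenvalues]
      rfl
    rw [h2] at h1
    exact_mod_cast h1
  · ext x y
    conv_rhs => rw [eq_conjDiag_eigenvectorBasis hH]
    rw [conjDiag, mul_apply]
    simp only [trFst, ketbra, of_apply, vecMulVec_apply, Pi.star_apply, basisMatrix, mul_diagonal,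
      conjTranspose_apply, EuclideanSpace.basisFun_apply, PiLp.single_apply, ite_mul,
      one_mul, zero_mul, mul_ite, mul_zero, Finset.sum_ite_eq, Finset.mem_univ, if_true, star_mul']
    have h1 := hsum fun i => hH.eigenvectorBasis i x * star (hH.eigenvectorBasis i y)
    refine Eq.trans ?_ (h1.trans ?_)
    · refine Finset.sum_congr rfl fun k _ => ?_
      have h2 : (√(ev (g k)) : ℂ) * (√(ev (g k)) : ℂ) = ev (g k) := by
        rw [← Complex.ofReal_mul, Real.mul_self_sqrt (hρ.1.eigenvalues_nonneg _)]
      rw [← h2, Complex.star_def, Complex.conj_ofReal]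
      ring
    · exact Finset.sum_congr rfl fun i _ => by simp only [ev]; ring
  · rw [← hK1]
    ext a a'
    rw [mul_apply, Fintype.sum_prod_type_right, Matrix.sum_apply]
    exact Finset.sum_congr rfl fun f _ => by rw [mul_apply]; rfl
  · rw [hK]
    ext b b'
    rw [krausMap_apply]
    simp only [trSnd, of_apply, mul_apply, conjTranspose_apply, Finset.sum_mul]
    exact Finset.sum_congr rfl fun f _ => Finset.sum_comm

theorem SWPurification.sigmaRE_isState (P : SWPurification ρ N) (hρ : IsState ρ)
    (hN : IsChannel N) : IsState P.sigmaRE := by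
  refine ⟨trMid_posSemidef (ketbra_posSemidef _), ?_⟩
  have hN' := hN
  rw [P.eq_krausMap] at hN'
  rw [SWPurification.sigmaRE, trace_trMid, ← trace_trSnd, P.sigmaVec_eq_krausVec, trSnd_krausVec,
    trace_ampliation hN', trace_ketbra, star_dotProduct_of_purifies hρ P.rhoVec P.purifies]

theorem nonempty_swSpectral (hρ : IsState ρ) (hN : IsChannel N) :
    Nonempty (SWSpectral ρ N) := by
  obtain ⟨P⟩ := nonempty_swPurification hρ hN
  have hE := P.sigmaRE_isState hρ hN
  have hE0 : P.sigmaE.PosSemidef := trFst_posSemidef hE.1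
  refine ⟨{ P with
    mu := hE0.1.eigenvalues, mu_nonneg := hE0.eigenvalues_nonneg, mu_sum := ?_
    e := hE0.1.eigenvectorBasis, spectral := ?_ }⟩
  · have h1 : P.sigmaE.trace = 1 := by rw [SWPurification.sigmaE, trace_trFst, hE.2]
    rw [hE0.1.trace_eq_sum_eigenvalues] at h1
    refine Complex.ofReal_injective ?_
    rw [Complex.ofReal_sum, Complex.ofReal_one]
    exact h1
  · conv_lhs => rw [eq_conjDiag_eigenvectorBasis hE0.1]
    exact (sum_smul_ketbra (basisMatrix hE0.1.eigenvectorBasis) _).symm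

/-- `|Ψ⟩` and `|σ⟩ ⊗ |0⟩` both purify `σ_{RE}` with the same purifying space, so a unitary `W`
relates them. Without this lemma the claim for every choice could be vacuous. -/
theorem nonempty_swConstruction (hρ : IsState ρ) (hN : IsChannel N) :
    Nonempty (SWConstruction ρ N) := by
  obtain ⟨S⟩ := nonempty_swSpectral hρ hN
  have hτ := (S.sigmaRE_isState hρ hN).1
  have hF := S.phiMatrix_mem_unitaryGroup
  obtain ⟨Z, hZ, V, hV, s, hs, hsvd⟩ := exists_svd S.opM
  obtain ⟨zero, hzero⟩ : ∃ zero : Fin ρ.rank × A → ℂ, star zero ⬝ᵥ zero = 1 := by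
    have hk : Nonempty (Fin ρ.rank) := by
      by_contra h
      rw [not_nonempty_iff] at h
      simpa using S.lam_sum
    have hA : Nonempty A := by
      by_contra h
      rw [not_nonempty_iff] at h
      simpa [Matrix.trace] using hρ.2
    obtain ⟨k⟩ := hk
    obtain ⟨x⟩ := hA
    exact ⟨Pi.single (k, x) 1, by simp⟩
  let T : Matrix (Fin ρ.rank × (A × B)) (Fin ρ.rank × (A × B)) ℂ :=
    Matrix.of fun x y => S.sigmaVec ((x.1, y.2.2), x.2) * zero (y.1, y.2.1)
  have hT : T * Tᴴ = S.sigmaRE := by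
    ext x x'
    have h1 (y : Fin ρ.rank × (A × B)) : T x y * Tᴴ y x' =
        (star (zero (y.1, y.2.1)) * zero (y.1, y.2.1)) *
          (S.sigmaVec ((x.1, y.2.2), x.2) * star (S.sigmaVec ((x'.1, y.2.2), x'.2))) := by
      simp only [T, conjTranspose_apply, of_apply, star_mul']
      ring
    rw [mul_apply]
    simp only [h1, Fintype.sum_prod_type]
    simp only [dotProduct, Fintype.sum_prod_type, Pi.star_apply] at hzero
    simp only [← Finset.mul_sum, ← Finset.sum_mul, hzero, one_mul]
    rfl
  obtain ⟨W, hW, hWT⟩ := exists_unitary_of_conjTranspose_mul_eq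
    (X := (rpow S.sigmaRE (1 / 2) * S.symUnitary)ᵀ) (Y := Tᵀ) (by
      have h1 (X : Matrix (Fin ρ.rank × (A × B)) (Fin ρ.rank × (A × B)) ℂ) :
          Xᵀᴴ * Xᵀ = (X * Xᴴ)ᵀ := by rw [transpose_mul]; rfl
      rw [h1, h1, hT, conjTranspose_mul, (rpow_half_isHermitian _).eq, Matrix.mul_assoc,
        ← Matrix.mul_assoc S.symUnitary, unitary_mul_conjTranspose S.symUnitary_mem_unitaryGroup,
        Matrix.one_mul, rpow_half_mul_self hτ])
  refine ⟨{ S with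
    -- The decomposition of `exists_svd` is diagonal in the standard basis; inserting `Φᴴ Φ = 1` on
    -- both sides moves it to the basis `|φ_{k,l}⟩`.
    Uhat := Z * S.phiMatrixᴴ
    Uhat_unitary := mul_mem hZ (conjTranspose_mem_unitaryGroup hF)
    Utilde := S.phiMatrix * V
    Utilde_unitary := mul_mem hF hV
    s := fun k l => s (k, l)
    s_nonneg := fun k l => hs (k, l)
    svd := ?_, zero := zero, zero_unit := hzero, W := W, W_unitary := hW, W_spec := ?_ }⟩
  · have h1 : ∑ k, ∑ l, (s (k, l) : ℂ) • ketbra (S.phi k l) (S.phi k l) =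
        S.phiMatrix * (diagonal fun i => (s i : ℂ)) * S.phiMatrixᴴ := by
      rw [← sum_smul_ketbra]
      symm
      exact Fintype.sum_prod_type _
    have h2 : S.phiMatrixᴴ * (S.phiMatrix * (diagonal fun i => (s i : ℂ)) * S.phiMatrixᴴ) *
        S.phiMatrix = diagonal fun i => (s i : ℂ) := diag_eq_of_conjDiag hF _
    change S.opM = _ * (∑ k, ∑ l, (s (k, l) : ℂ) • ketbra (S.phi k l) (S.phi k l)) * _
    rw [h1, hsvd]
    conv_lhs => rw [← h2]
    simp only [Matrix.mul_assoc]
  · intro x y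
    rw [S.psiVec_eq]
    have := congrFun (congrFun hWT y) x
    rw [transpose_apply, mul_apply] at this
    exact this

end Existence

end

end QRecovery

/-! ### The cycle of implications. -/

open QRecovery
theorem corollary3 {A B R : Type*} [Fintype A] [DecidableEq A] [Fintype B] [DecidableEq B]
    [Fintype R] [DecidableEq R]
    (ρ : Matrix A A ℂ) (hρ : IsState ρ)
    (N : Matrix A A ℂ → Matrix B B ℂ) (hN : IsChannel N)
    -- a purification `|ρ⟩` of `ρ` on `R ⊗ A`
    (ψ : R × A → ℂ) (hψ : trFst (ketbra ψ ψ) = ρ)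
    -- the state `σ_{RB} = N(|ρ⟩⟨ρ|)`
    (σRB : Matrix (R × B) (R × B) ℂ) (hσ : σRB = ampliation N (ketbra ψ ψ)) :
    List.TFAE [
      -- some decoder achieves perfect recovery
      ∃ D : Matrix B B ℂ → Matrix A A ℂ, IsChannel D ∧ entanglementFidelity ρ (D ∘ N) = 1,
      -- the Schumacher-Westmoreland decoder achieves perfect recovery,
      -- for every outcome of the choices in its construction, and equivalently for some
      ∀ C : SWConstruction ρ N, entanglementFidelity ρ (C.decoder ∘ N) = 1,
      ∃ C : SWConstruction ρ N, entanglementFidelity ρ (C.decoder ∘ N) = 1,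
      -- the Petz decoder achieves perfect recovery
      entanglementFidelity ρ (petzDecoder ρ N ∘ N) = 1,
      -- the twirled Petz decoder achieves perfect recovery
      entanglementFidelity ρ (twirledPetzDecoder ρ N ∘ N) = 1,
      -- `H(R|B)_σ = H(R|A)_ρ`
      condEntropy σRB = condEntropy (ketbra ψ ψ),
      -- `σ_{RE} = σ_R ⊗ σ_E` for every purification of `σ_{RB}`, and equivalently for some
      ∀ (E : Type) [Fintype E] (φ : (R × B) × E → ℂ), trSnd (ketbra φ φ) = σRB →
        trMid (ketbra φ φ) = trSnd (trMid (ketbra φ φ)) ⊗ₖ trFst (trMid (ketbra φ φ)),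
      ∃ (E : Type) (_ : Fintype E) (φ : (R × B) × E → ℂ), trSnd (ketbra φ φ) = σRB ∧
        trMid (ketbra φ φ) = trSnd (trMid (ketbra φ φ)) ⊗ₖ trFst (trMid (ketbra φ φ))] := by
  obtain ⟨K, rfl⟩ := exists_krausMap hN.1 hN.2
  subst hσ
  have hcan := canonicalPurification_purifies hρ.1
  have hpos := krausMap_posSemidef hρ.1 K
  have hrot (t : ℝ) : IsLinearMap ℂ (rotatedPetz ρ (krausMap K) t) ∧
      IsCompletelyPositive (rotatedPetz ρ (krausMap K) t) := by
    rw [rotatedPetz_krausMap hρ.1]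
    exact ⟨krausMap_isLinearMap _, krausMap_isCompletelyPositive _⟩
  have htwirl : IsLinearMap ℂ (twirledPetzDecoder ρ (krausMap K)) ∧
      IsCompletelyPositive (twirledPetzDecoder ρ (krausMap K)) := by
    rw [twirledPetzDecoder_krausMap hρ.1]
    exact ⟨averageMap_isLinearMap integrable_beta0 (isBoundedContinuous_petzKraus hρ.1 K),
      averageMap_isCompletelyPositive integrable_beta0 beta0_nonneg
        (isBoundedContinuous_petzKraus hρ.1 K)⟩
  tfae_have 1 → 2 := by
    rintro ⟨D, hD, hF⟩ C
    refine entanglementFidelity_eq_one_of_ampliation hρ (C.decoder_isChannel.comp hN).1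
      (C.decoder_isChannel.comp hN).2 C.purifies (C.ampliation_decoder hN ?_)
    refine trMid_eq_kronecker_of_recovery hρ hN hD hF (ψ := C.rhoVec) C.purifies ?_
    rw [C.sigmaVec_eq_krausVec, trSnd_krausVec, ← C.eq_krausMap]
  tfae_have 2 → 3 := fun h =>
    let ⟨C⟩ := nonempty_swConstruction hρ hN
    ⟨C, h C⟩
  tfae_have 3 → 1 := fun ⟨C, h⟩ => ⟨C.decoder, C.decoder_isChannel, h⟩
  tfae_have 4 → 1 := by
    intro h
    rw [petzDecoder_eq_rotatedPetz hρ.1 hpos] at h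
    refine exists_channel_of_recovery hρ hN (hrot 0).1 (hrot 0).2 (cpow_zero_isHermitian hpos)
      (cpow_zero_mul_self hpos) (fun X => ?_) h
    rw [rotatedPetz_krausMap hρ.1, trace_krausMap, sum_petzKraus hρ.1]
  tfae_have 5 → 1 := by
    intro h
    refine exists_channel_of_recovery hρ hN htwirl.1 htwirl.2 (cpow_zero_isHermitian hpos)
      (cpow_zero_mul_self hpos) (fun X => ?_) h
    rw [twirledPetzDecoder_krausMap hρ.1]
    exact trace_averageMap integrable_beta0 integral_beta0
      (isBoundedContinuous_petzKraus hρ.1 K) (fun t => sum_petzKraus hρ.1 K _) X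
  have hamp (h : condEntropy (ampliation (krausMap K) (ketbra ψ ψ)) = condEntropy (ketbra ψ ψ)) :
      ∀ t, ampliation (rotatedPetz ρ (krausMap K) t ∘ krausMap K)
        (ketbra (canonicalPurification ρ) (canonicalPurification ρ)) =
        ketbra (canonicalPurification ρ) (canonicalPurification ρ) :=
    ampliation_rotatedPetz hρ hN ((condEntropy_eq_iff hρ hN hcan (trSnd_krausVec K _)).1
      ((condEntropy_eq_iff_of_purifications hρ hN hψ hcan).1 h))
  tfae_have 6 → 4 := by
    intro h
    rw [petzDecoder_eq_rotatedPetz hρ.1 hpos]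
    exact entanglementFidelity_eq_one_of_ampliation hρ (isLinearMap_comp (hrot 0).1 hN.1)
      (IsCompletelyPositive.comp (hrot 0).2 hN.2) hcan (hamp h 0)
  tfae_have 6 → 5 := fun h =>
    entanglementFidelity_eq_one_of_ampliation hρ (isLinearMap_comp htwirl.1 hN.1)
      (IsCompletelyPositive.comp htwirl.2 hN.2) hcan (ampliation_twirledPetz (hamp h))
  tfae_have 1 → 7 := by
    classical
    rintro ⟨D, hD, hF⟩ E _ φ hφ
    exact trMid_eq_kronecker_of_recovery hρ hN hD hF hψ hφ
  tfae_have 7 → 8 := by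
    intro h
    -- The environment must lie in `Type`, while `A × B` may live in a higher universe, so the Kraus
    -- operators are reindexed by `Fin`.
    let g := Fintype.equivFin (A × B)
    let K' : Fin (Fintype.card (A × B)) → Matrix B A ℂ := fun i => K (g.symm i)
    have hK' : krausMap K' = krausMap K := by
      funext X
      exact g.symm.sum_comp fun e => K e * X * (K e)ᴴ
    have h1 := trSnd_krausVec K' ψ
    rw [hK'] at h1
    exact ⟨_, inferInstance, krausVec K' ψ, h1, h _ _ h1⟩
  tfae_have 8 → 6 := by
    classical
    rintro ⟨E, _, φ, hφ, h⟩
    exact (condEntropy_eq_iff hρ hN hψ hφ).2 h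
  tfae_finish
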